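/- Let $d\ge 2$ and $\lambda>0$. For a finite set $\Lambda\subset\mathbb Z^d$ let $Z_\Lambda=\sum_M\lambda^{|M|}$, the sum being over all matchings $M$ of the subgraph of the nearest-neighbour lattice $\mathbb Z^d$ induced by $\Lambda$ (the monomer-dimer model). For $a\in\mathbb R_{>0}^d$ let $B_{an}=\{u\in\mathbb Z^d:|u_j|\le a_jn,\ 1\le j\le d\}$ and $A(a)=\sum_{j}A_j(a)$ with $A_j(a)=\prod_{k\ne j}2a_k$. The free energy is $$\mathcal P(d,\lambda)=\lim_{n\to\infty}\frac{\log Z_{\Lambda_n}}{|\Lambda_n|}$$ along every sequence of nonempty finite sets $\Lambda_n\subset\mathbb Z^d$ with $|\partial\Lambda_n|/|\Lambda_n|\to0$, where $\partial\Lambda$ is the set of vertices of $\Lambda$ with a neighbour outside $\Lambda$; the surface pressure is $$s\mathcal P(d,\lambda,a)=\lim_{n\to\infty}\frac{\log Z_{B_{an}}-|B_{an}|\,\mathcal P(d,\lambda)}{A(a)\,n^{d-1}} .$$ For a subgraph $G$ of $\mathbb Z^d$, a vertex $v$ of $G$ and $t\ge0$ let $\Phi_G(v,0)=1$ and $\Phi_G(v,t+1)=\bigl(1+\lambda\sum_{u}\Phi_{G-v}(u,t)\bigr)^{-1}$,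 the sum being over the neighbours $u$ of $v$ in $G$. Let $\mathbb Z^d_{\preceq0}$ be the set consisting of the origin and of all vertices preceding it in the lexicographic order whose most significant coordinate is the last one, and let $\Phi(t)$, $\Phi_{j,k,+}(t)$, $\Phi_{j,k,-}(t)$ be the values $\Phi_G(0,t)$ for $G$ induced by $\mathbb Z^d_{\preceq0}$, by $\{v\in\mathbb Z^d_{\preceq0}:v_j\le k\}$ and by $\{v\in\mathbb Z^d_{\preceq0}:v_j\ge-k\}$, respectively. The sequential cavity algorithm (SCA) evaluates these recursions and, for a target error $\epsilon>0$, returns $$-\log\Phi(t)\quad\text{and}\quad\sum_{j=1}^d\frac{A_j(a)}{A(a)}\sum_{k=0}^{t-1}\bigl(2\log\Phi(t)-\log\Phi_{j,k,+}(t)-\log\Phi_{j,k,-}(t)\bigr)$$ as its estimates of $\mathcal P(d,\lambda)$ and $s\mathcal P(d,\lambda,a)$. The depth is $t=2\lceil 10\,s\,(1+\log(1+1/\delta))\rceil$, where $s=\sqrt{1+2\lambda d}$, with $\delta=\epsilon$ for the free energy and $\delta=\epsilon/s$ for the surface pressure. Time is the number of elementary steps, with unit cost for operations on real numbers (arithmetic,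 comparison, square root, logarithm) and on integers. There is a universal constant $C>0$ such that for all $d\ge2$, $\lambda>0$ the limit $\mathcal P(d,\lambda)$ exists, for all $a\in\mathbb R_{>0}^d$ the limit $s\mathcal P(d,\lambda,a)$ exists, and for every $\epsilon>0$ the SCA produces 1. an estimate of $\mathcal P(d,\lambda)$ with additive error at most $\epsilon$ in time at most $\log(2+2\lambda d)\,\bigl(2+\tfrac1\epsilon\bigr)^{C(1+\lambda d)^{1/2}\log d}$; 2. an estimate of $s\mathcal P(d,\lambda,a)$ with additive error at most $\epsilon$ in time at most $\log(2+2\lambda d)\,\bigl(2+\lambda d+\tfrac1\epsilon\bigr)^{C(1+\lambda d)^{1/2}\log d}$. -/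

import Mathlib

open Topology

/-! ### The lattice and the monomer-dimer partition function -/

/-- The nearest-neighbour graph on `ℤ^d`: `u` and `v` are adjacent iff their `ℓ¹`-distance is `1`. -/
def latticeGraph (d : ℕ) : SimpleGraph (Fin d → ℤ) where
  Adj u v := ∑ i, |u i - v i| = 1
  symm := ⟨fun u v h => by simpa only [abs_sub_comm] using h⟩
  loopless := ⟨fun v h => by simp at h⟩

/-- `M` is a matching of `G`: a set of edges of `G`, no two of which share a vertex. -/
def IsMatchingSet {V : Type*} (G : SimpleGraph V) (M : Finset (Sym2 V)) : Prop :=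
  (∀ e ∈ M, e ∈ G.edgeSet) ∧ ∀ e ∈ M, ∀ f ∈ M, e ≠ f → ∀ v, v ∈ e → v ∉ f

open Classical in
/-- The partition function `∑_M lam ^ |M|`, over all matchings `M` of the subgraph of `ℤ^d` induced
by the finite set `S` (`S.sym2` is the set of unordered pairs of elements of `S`). -/
noncomputable def partitionFunction (d : ℕ) (lam : ℝ) (S : Finset (Fin d → ℤ)) : ℝ :=
  ∑ M ∈ S.sym2.powerset with IsMatchingSet (latticeGraph d) M, lam ^ M.card

open Classical in
/-- The inner boundary of `S`: the vertices of `S` with a neighbour outside `S`. -/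
noncomputable def innerBoundary (d : ℕ) (S : Finset (Fin d → ℤ)) : Finset (Fin d → ℤ) :=
  S.filter fun v => ∃ u, (latticeGraph d).Adj v u ∧ u ∉ S

/-- Van Hove sequences of nonempty finite subsets of `ℤ^d`. -/
def IsVanHove (d : ℕ) (S : ℕ → Finset (Fin d → ℤ)) : Prop :=
  (∀ n, (S n).Nonempty) ∧
    Filter.Tendsto (fun n => ((innerBoundary d (S n)).card : ℝ) / ((S n).card : ℝ)) Filter.atTop (𝓝 0)

/-- `P` is the free energy (pressure): `log Z_S / |S|` tends to `P` along every van Hove sequence. -/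
def IsFreeEnergy (d : ℕ) (lam P : ℝ) : Prop :=
  ∀ S : ℕ → Finset (Fin d → ℤ), IsVanHove d S →
    Filter.Tendsto (fun n => Real.log (partitionFunction d lam (S n)) / ((S n).card : ℝ)) Filter.atTop (𝓝 P)

/-- The box `{u ∈ ℤ^d : |u_j| ≤ a_j n for all j}`. -/
noncomputable def rectBox {d : ℕ} (a : Fin d → ℝ) (n : ℕ) : Finset (Fin d → ℤ) :=
  Fintype.piFinset fun i => Finset.Icc (-⌊a i * n⌋) ⌊a i * n⌋

/-- The rescaled surface area `A(a) = ∑_j ∏_{k ≠ j} (2 a_k)`. -/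
noncomputable def surfaceArea {d : ℕ} (a : Fin d → ℝ) : ℝ :=
  ∑ j, ∏ k ∈ Finset.univ.erase j, (2 * a k)

/-- `s` is the surface pressure for the rectangular shape `a`, where `P` is the free energy:
`(log Z_B - |B| P) / (A(a) n^(d-1))` tends to `s`, where `B` is the box of shape `a` and scale `n`. -/
def IsSurfacePressure (d : ℕ) (lam P : ℝ) (a : Fin d → ℝ) (s : ℝ) : Prop :=
  Filter.Tendsto (fun n : ℕ =>
    (Real.log (partitionFunction d lam (rectBox a n)) - ((rectBox a n).card : ℝ) * P) /
      (surfaceArea a * (n : ℝ) ^ (d - 1))) Filter.atTop (𝓝 s)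

/-! ### Subsets of the lattice used by the algorithm -/

/-- The lexicographic order on `ℤ^d` in which the last coordinate is the most significant one. -/
def lexPrec {d : ℕ} (v u : Fin d → ℤ) : Prop :=
  ∃ k, v k < u k ∧ ∀ j, k < j → v j = u j

/-- The vertices preceding the origin, together with the origin. -/
def cavityHalf (d : ℕ) : Set (Fin d → ℤ) := {u | lexPrec u 0 ∨ u = 0}

/-- The part of `cavityHalf d` in the half-space `u_j ≤ k`. -/
def cavityUpper (d : ℕ) (j : Fin d) (k : ℕ) : Set (Fin d → ℤ) :=
  {u | u ∈ cavityHalf d ∧ u j ≤ (k : ℤ)}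

/-- The part of `cavityHalf d` in the half-space `u_j ≥ -k`. -/
def cavityLower (d : ℕ) (j : Fin d) (k : ℕ) : Set (Fin d → ℤ) :=
  {u | u ∈ cavityHalf d ∧ -(k : ℤ) ≤ u j}

/-- The `2d` unit steps of the lattice. -/
def unitSteps (d : ℕ) : List (Fin d → ℤ) :=
  (List.finRange d).flatMap fun i => [Pi.single i 1, Pi.single i (-1)]

/-! ### Computations with a step count

The machine works with unit cost on real numbers and integers: each arithmetic operation,
comparison, square root or logarithm, each list operation and each pass through a loop is one step.
An operation on vertices of `ℤ^d` is charged for each of the coordinates. -/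

/-- The result of a computation together with the number of elementary steps it has taken. -/
structure Timed (α : Type) where
  val : α
  steps : ℕ

namespace Timed

instance : Monad Timed where
  pure x := ⟨x, 0⟩
  bind m f := ⟨(f m.val).val, m.steps + (f m.val).steps⟩

/-- A computation of `x` that takes `c` elementary steps. -/
def instr {α : Type} (c : ℕ) (x : α) : Timed α := ⟨x, c⟩

/-- One pass through a loop. -/
def tick : Timed Unit := instr 1 ()

noncomputable def add (x y : ℝ) : Timed ℝ := instr 1 (x + y)
noncomputable def sub (x y : ℝ) : Timed ℝ := instr 1 (x - y)
noncomputable def mul (x y : ℝ) : Timed ℝ := instr 1 (x * y)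
noncomputable def div (x y : ℝ) : Timed ℝ := instr 1 (x / y)
noncomputable def sqrt (x : ℝ) : Timed ℝ := instr 1 (Real.sqrt x)
noncomputable def log (x : ℝ) : Timed ℝ := instr 1 (Real.log x)

/-- Rounding up to a natural number, by counting upwards from `0` until `x` is reached. -/
noncomputable def ceil (x : ℝ) : Timed ℕ := instr (2 * ⌈x⌉₊ + 1) ⌈x⌉₊

/-- The vertex `v + e`, one step for each coordinate. -/
def translate {d : ℕ} (v e : Fin d → ℤ) : Timed (Fin d → ℤ) := instr d (v + e)

open Classical in
/-- Test whether `u` lies in `R`. This is used only when `R` is `cavityHalf d` or its intersection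
with a coordinate half-space: scanning the `d` coordinates from the last one (each is compared
with `0` from both sides) and one comparison for the half-space. -/
noncomputable def inRegion {d : ℕ} (R : Set (Fin d → ℤ)) (u : Fin d → ℤ) : Timed Bool :=
  instr (2 * d + 1) (decide (u ∈ R))

/-- Test whether `u` occurs in the list `Y`, by comparing it with all entries. -/
def inList {d : ℕ} (Y : List (Fin d → ℤ)) (u : Fin d → ℤ) : Timed Bool :=
  instr (Y.length * (d + 1) + 1) (decide (u ∈ Y))

end Timed

/-! ### The sequential cavity algorithm -/

/-- The truncated cavity recursion. With `G` the subgraph of `ℤ^d` induced by the vertices of `R`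
that are not in the list `X`, this computes `Φ_G(v, t)`, where `Φ_G(v, 0) = b` and
`Φ_G(v, t + 1) = 1 / (1 + lam * ∑_u Φ_{G - v}(u, t))`, the sum being over the neighbours of `v`
in `G`. -/
noncomputable def cavity {d : ℕ} (lam : ℝ) (R : Set (Fin d → ℤ)) (b : ℝ) :
    ℕ → List (Fin d → ℤ) → (Fin d → ℤ) → Timed ℝ
  | 0, _, _ => Timed.instr 1 b
  | t + 1, X, v => do
    let Y ← Timed.instr 1 (v :: X)
    let s ← (unitSteps d).foldlM (init := (0 : ℝ)) fun s e => do
      Timed.tick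
      let u ← Timed.translate v e
      let inside ← Timed.inRegion R u
      let removed ← Timed.inList Y u
      if inside && !removed then
        let x ← cavity lam R b t Y u
        Timed.add s x
      else
        pure s
    let p ← Timed.mul lam s
    let q ← Timed.add 1 p
    Timed.div 1 q

/-- The number `√(1 + 2 * lam * d)`. -/
noncomputable def scaScale (d : ℕ) (lam : ℝ) : Timed ℝ := do
  let x ← Timed.mul 2 lam
  let y ← Timed.mul x d
  let z ← Timed.add 1 y
  Timed.sqrt z

/-- The depth `2 * ⌈10 * √(1 + 2 * lam * d) * (1 + log (1 + 1 / δ))⌉` of the recursion. -/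
noncomputable def scaDepth (d : ℕ) (lam δ : ℝ) : Timed ℕ := do
  let s ← scaScale d lam
  let x ← Timed.div 1 δ
  let y ← Timed.add 1 x
  let l ← Timed.log y
  let z ← Timed.add 1 l
  let w ← Timed.mul s z
  let r ← Timed.mul 10 w
  let m ← Timed.ceil r
  Timed.instr 1 (2 * m)

/-- `log Φ(t)`, where `Φ` is the truncated cavity recursion at the origin in the region `R`, with
the value `1` at depth `0`. -/
noncomputable def logCavity {d : ℕ} (lam : ℝ) (R : Set (Fin d → ℤ)) (t : ℕ) : Timed ℝ := do
  let o ← Timed.instr d (0 : Fin d → ℤ)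
  let x ← cavity lam R 1 t [] o
  Timed.log x

/-- The sequential cavity algorithm for the free energy. -/
noncomputable def scaFreeEnergy (d : ℕ) (lam ε : ℝ) : Timed ℝ := do
  let t ← scaDepth d lam ε
  let l ← logCavity lam (cavityHalf d) t
  Timed.sub 0 l

/-- The sequential cavity algorithm for the surface pressure of the shape `a`. It returns
`∑_j (A_j(a) / A(a)) * ∑_{k < t} (2 log Φ - log Φ_{j,k,+} - log Φ_{j,k,-})`, all at depth `t`;
note that `A_j(a) / A(a) = (1 / a_j) / ∑_i (1 / a_i)`. -/
noncomputable def scaSurfacePressure (d : ℕ) (lam : ℝ) (a : Fin d → ℝ) (ε : ℝ) : Timed ℝ := do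
  let s ← scaScale d lam
  let δ ← Timed.div ε s
  let t ← scaDepth d lam δ
  let l ← logCavity lam (cavityHalf d) t
  let l2 ← Timed.mul 2 l
  let total ← (List.finRange d).foldlM (init := (0 : ℝ)) fun w i => do
    Timed.tick
    let x ← Timed.div 1 (a i)
    Timed.add w x
  (List.finRange d).foldlM (init := (0 : ℝ)) fun r j => do
    Timed.tick
    let acc ← (List.range t).foldlM (init := (0 : ℝ)) fun c k => do
      Timed.tick
      let up ← logCavity lam (cavityUpper d j k) t
      let low ← logCavity lam (cavityLower d j k) t
      let x ← Timed.sub l2 up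
      let y ← Timed.sub x low
      Timed.add c y
    let x ← Timed.div 1 (a j)
    let w ← Timed.div x total
    let z ← Timed.mul w acc
    Timed.add r z

/-! Deleting the vertices of a finite set `S` one by one, from the lexicographically last,
telescopes `log Z_S` into a sum of terms `-log p_v`, where `p_v` is the probability that `v` is
unmatched in the part of `S` up to `v` (`log_partitionFunction_eq_sum`). Sorting matchings by the
partner of a vertex shows that such probabilities solve the cavity recursion exactly
(`monomerProb_fixed`). Everything then rests on one fact: the recursion forgets its boundary values
exponentially fast, uniformly in the region and in the deleted vertices.

That fact is `cavityValue_contraction`. If two solutions have ratio at most `1 + 1/sinh² θ`, then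
two levels up the bound is `1 + 1/sinh² (θ + φ)`, where `2λd sinh² φ = 1`, that is `tanh φ = 1/s`
with `s = √(1 + 2λd)`. As `φ ≥ 1/s`, the logarithmic error at depth `n` is at most `1/sinh²
((n+1)/(2s))`, of order `exp(-n/s)` for large `n`. A depth of order `s (1 + log(1 + 1/δ))` therefore
suffices, and a recursion tree with at most `2d` branches per node gives the running time.

Far from the boundary, the part of `S` up to `v` looks like the half-lattice, so the free energy is
`-lim log Φ`. In a box, a vertex near a single face sees the half-lattice cut by that face; its
correction depends only on the distance to the face and is summable in it. Interactions between two
faces contribute `o(n^(d-1))`. Hence the surface pressure is the area-weighted sum of these series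
over the faces, which the algorithm truncates. -/

section

variable {d : ℕ}

/-! ### Contraction of the cavity recursion -/

/-- Turns the contraction angle `artanh (1/s)` into the explicit lower bound `1/s`. The function `y
cosh y - sinh y` vanishes at `0` and has derivative `y sinh y ≥ 0`. -/
theorem Real.tanh_le_self {x : ℝ} (hx : 0 ≤ x) : Real.tanh x ≤ x := by
  have hmono : MonotoneOn (fun y : ℝ => y * Real.cosh y - Real.sinh y) (Set.Ici 0) := by
    refine monotoneOn_of_hasDerivWithinAt_nonneg (f' := fun y => y * Real.sinh y) (convex_Ici 0)
      (by fun_prop) (fun y _ => ?_) (fun y hy => ?_)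
    · have h : HasDerivAt (fun y : ℝ => y * Real.cosh y - Real.sinh y)
          (1 * Real.cosh y + y * Real.sinh y - Real.cosh y) y :=
        ((hasDerivAt_id y).mul (Real.hasDerivAt_cosh y)).sub (Real.hasDerivAt_sinh y)
      exact (h.congr_deriv (by ring)).hasDerivWithinAt
    · rw [interior_Ici] at hy
      exact mul_nonneg (le_of_lt hy) (Real.sinh_nonneg_iff.2 (le_of_lt hy))
  have h := hmono (Set.mem_Ici.2 le_rfl) (Set.mem_Ici.2 hx) hx
  simp only [zero_mul, Real.sinh_zero, sub_zero] at h
  rw [Real.tanh_eq_sinh_div_cosh, div_le_iff₀ (Real.cosh_pos x)]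
  linarith

/-- If `x = 1/(1+S)` and `x' = 1/(1+S')` are the two new values, this is `w S ≤ (1+w) S'` rewritten
through `S = 1/x - 1`. The recursion is decreasing, so the roles of `x` and `x'` swap; the gain over
`w x' ≤ (1+w) x` is the term `-x'`. -/
theorem cavity_ratio_inner {ι : Type*} {I : Finset ι} {y y' : ι → ℝ} {lam w : ℝ} (hlam : 0 < lam)
    (hy : ∀ i ∈ I, 0 ≤ y i) (hy' : ∀ i ∈ I, 0 ≤ y' i)
    (h : ∀ i ∈ I, w * y i ≤ (1 + w) * y' i) :
    w * (1 / (1 + lam * ∑ i ∈ I, y' i)) ≤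
      1 / (1 + lam * ∑ i ∈ I, y i) * (w + 1 - 1 / (1 + lam * ∑ i ∈ I, y' i)) := by
  have hS : 0 ≤ lam * ∑ i ∈ I, y i := mul_nonneg hlam.le (Finset.sum_nonneg hy)
  have hS' : 0 ≤ lam * ∑ i ∈ I, y' i := mul_nonneg hlam.le (Finset.sum_nonneg hy')
  have hle : w * (lam * ∑ i ∈ I, y i) ≤ (1 + w) * (lam * ∑ i ∈ I, y' i) := by
    have := Finset.sum_le_sum h
    rw [← Finset.mul_sum, ← Finset.mul_sum] at this
    nlinarith
  set S := lam * ∑ i ∈ I, y i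
  set S' := lam * ∑ i ∈ I, y' i
  have e : 1 / (1 + S) * (w + 1 - 1 / (1 + S')) - w * (1 / (1 + S')) =
      ((1 + w) * S' - w * S) / ((1 + S) * (1 + S')) := by
    field_simp
    ring
  have : 0 ≤ ((1 + w) * S' - w * S) / ((1 + S) * (1 + S')) := by
    apply div_nonneg <;> nlinarith
  linarith

/-- Inserting the lower bound for `x` contained in `h` leaves an inequality in `x'` alone.
Multiplied by `sinh² θ + 1 - x'`, the gap between its two sides is exactly the square of `sinh (θ+φ)
x' - cosh θ sinh φ`; this is why angles add. -/
theorem cavity_ratio_vertex {x x' θ φ : ℝ} (hx'1 : x' ≤ 1)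
    (hθ : 0 < Real.sinh θ) (h : Real.sinh θ ^ 2 * x' ≤ x * (Real.sinh θ ^ 2 + 1 - x')) :
    Real.sinh (θ + φ) ^ 2 * x' - (1 + Real.sinh (θ + φ) ^ 2) * x ≤ Real.sinh φ ^ 2 := by
  have hc := Real.cosh_sq θ
  have hc' := Real.cosh_sq φ
  set W := Real.sinh (θ + φ) ^ 2 with hW
  have hWe : W = (Real.sinh θ * Real.cosh φ + Real.cosh θ * Real.sinh φ) ^ 2 := by
    rw [hW, Real.sinh_add]
  set w := Real.sinh θ ^ 2
  have hw : 0 < w := by positivity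
  have hpos : 0 < w + 1 - x' := by linarith
  have hW0 : 0 ≤ W := by positivity
  have hsq : 0 ≤ (Real.sinh (θ + φ) * x' - Real.cosh θ * Real.sinh φ) ^ 2 := sq_nonneg _
  have key : W * x' * (w + 1 - x') - (1 + W) * (w * x') ≤ Real.sinh φ ^ 2 * (w + 1 - x') := by
    have e : (Real.sinh (θ + φ) * x' - Real.cosh θ * Real.sinh φ) ^ 2 =
        W * x' ^ 2 - 2 * (Real.cosh θ * Real.sinh φ) *
          (Real.sinh θ * Real.cosh φ + Real.cosh θ * Real.sinh φ) * x'
          + (w + 1) * Real.sinh φ ^ 2 := by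
      rw [← hc, hW, ← Real.sinh_add]; ring
    have e2 : 2 * (Real.cosh θ * Real.sinh φ) *
          (Real.sinh θ * Real.cosh φ + Real.cosh θ * Real.sinh φ) = W - w + Real.sinh φ ^ 2 := by
      have : W = w * (Real.sinh φ ^ 2 + 1) + (w + 1) * Real.sinh φ ^ 2 +
          2 * (Real.cosh θ * Real.sinh φ) * (Real.sinh θ * Real.cosh φ) := by
        rw [hWe, ← hc, ← hc']; ring
      have h3 : 2 * (Real.cosh θ * Real.sinh φ) * (Real.cosh θ * Real.sinh φ) =
          2 * ((w + 1) * Real.sinh φ ^ 2) := by rw [← hc]; ring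
      linarith
    rw [e, e2] at hsq
    nlinarith
  have : (1 + W) * (w * x') ≤ (1 + W) * (x * (w + 1 - x')) :=
    mul_le_mul_of_nonneg_left h (by linarith)
  refine le_of_mul_le_mul_right ?_ hpos
  nlinarith

/-- Summed over the neighbours and multiplied by `lam`, the vertex bound costs at most `D sinh² φ =
1`, which the constant `1` in the denominators pays for. Combined with `cavity_ratio_inner`, two
levels advance the angle by `φ`. -/
theorem cavity_ratio_outer {ι : Type*} {I : Finset ι} {x x' : ι → ℝ} {lam D θ φ : ℝ}
    (hlam : 0 < lam) (hI : I.card * lam ≤ D) (hD : D * Real.sinh φ ^ 2 = 1)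
    (hθ : 0 < Real.sinh θ) (hx : ∀ i ∈ I, 0 ≤ x i) (hx' : ∀ i ∈ I, 0 ≤ x' i)
    (hx'1 : ∀ i ∈ I, x' i ≤ 1)
    (h : ∀ i ∈ I, Real.sinh θ ^ 2 * x' i ≤ x i * (Real.sinh θ ^ 2 + 1 - x' i)) :
    Real.sinh (θ + φ) ^ 2 * (1 / (1 + lam * ∑ i ∈ I, x i)) ≤
      (1 + Real.sinh (θ + φ) ^ 2) * (1 / (1 + lam * ∑ i ∈ I, x' i)) := by
  have hsum : ∑ i ∈ I, (Real.sinh (θ + φ) ^ 2 * x' i - (1 + Real.sinh (θ + φ) ^ 2) * x i) ≤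
      I.card * Real.sinh φ ^ 2 := by
    refine (Finset.sum_le_card_nsmul I _ (Real.sinh φ ^ 2) fun i hi =>
      cavity_ratio_vertex (hx'1 i hi) hθ (h i hi)).trans (by rw [nsmul_eq_mul])
  rw [Finset.sum_sub_distrib, ← Finset.mul_sum, ← Finset.mul_sum] at hsum
  have hS : 0 ≤ lam * ∑ i ∈ I, x i := mul_nonneg hlam.le (Finset.sum_nonneg hx)
  have hS' : 0 ≤ lam * ∑ i ∈ I, x' i := mul_nonneg hlam.le (Finset.sum_nonneg hx')
  have h1 : lam * (I.card * Real.sinh φ ^ 2) ≤ 1 := by nlinarith [sq_nonneg (Real.sinh φ)]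
  have h2 := (mul_le_mul_of_nonneg_left hsum hlam.le).trans h1
  rw [mul_one_div, mul_one_div, div_le_div_iff₀ (by linarith) (by linarith)]
  nlinarith

/-! ### The cavity recursion with general boundary values -/

theorem length_unitSteps (d : ℕ) : (unitSteps d).length = 2 * d := by
  simp [unitSteps, List.length_flatMap, mul_comm]

theorem nodup_unitSteps (d : ℕ) : (unitSteps d).Nodup := by
  rw [unitSteps, List.nodup_flatMap]
  refine ⟨fun i _ => ?_, (List.nodup_finRange d).imp ?_⟩
  · simp only [List.nodup_cons, List.mem_cons, List.not_mem_nil, or_false, not_false_eq_true,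
      List.nodup_nil, and_self, and_true]
    intro h
    have := congrFun h i
    simp at this
  · intro i j hij
    simp only [Function.onFun, List.disjoint_cons_left, List.mem_cons, List.not_mem_nil, or_false,
      List.disjoint_nil_left, and_true, not_or]
    refine ⟨⟨fun h => ?_, fun h => ?_⟩, fun h => ?_, fun h => ?_⟩ <;>
    · have := congrFun h i
      simp [hij] at this

open Classical in
/-- The unit steps from `v` to the neighbours of `v` in `R` that do not occur in `v :: X`. -/
noncomputable def openSteps (R : Set (Fin d → ℤ)) (X : List (Fin d → ℤ)) (v : Fin d → ℤ) :
    Finset (Fin d → ℤ) :=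
  (unitSteps d).toFinset.filter fun e => v + e ∈ R ∧ v + e ∉ v :: X

theorem mem_openSteps {R : Set (Fin d → ℤ)} {X : List (Fin d → ℤ)} {v e : Fin d → ℤ} :
    e ∈ openSteps R X v ↔ e ∈ unitSteps d ∧ v + e ∈ R ∧ v + e ∉ v :: X := by
  simp [openSteps]

theorem card_openSteps_le (R : Set (Fin d → ℤ)) (X : List (Fin d → ℤ)) (v : Fin d → ℤ) :
    (openSteps R X v).card ≤ 2 * d := by
  classical
  rw [← length_unitSteps d]
  exact (Finset.card_filter_le _ _).trans (List.toFinset_card_le _)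

theorem card_openSteps_mul_le {lam : ℝ} (hlam : 0 < lam) (R : Set (Fin d → ℤ))
    (X : List (Fin d → ℤ)) (v : Fin d → ℤ) : ((openSteps R X v).card : ℝ) * lam ≤ 2 * lam * d := by
  have h : ((openSteps R X v).card : ℝ) ≤ 2 * d := by exact_mod_cast card_openSteps_le R X v
  nlinarith

/-- The cavity recursion of depth `t` in the region `R`, started from the boundary values `B`. -/
noncomputable def cavityValue (lam : ℝ) (R : Set (Fin d → ℤ)) (B : List (Fin d → ℤ) → (Fin d → ℤ) → ℝ) :
    ℕ → List (Fin d → ℤ) → (Fin d → ℤ) → ℝ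
  | 0, X, v => B X v
  | t + 1, X, v =>
    1 / (1 + lam * ∑ e ∈ openSteps R X v, cavityValue lam R B t (v :: X) (v + e))

/-- Boundary values in the range of the cavity recursion. -/
def IsCavityBoundary (d : ℕ) (lam : ℝ) (B : List (Fin d → ℤ) → (Fin d → ℤ) → ℝ) : Prop :=
  ∀ X v, 1 / (1 + 2 * lam * d) ≤ B X v ∧ B X v ≤ 1

section

variable {lam : ℝ} {R : Set (Fin d → ℤ)} {B B' : List (Fin d → ℤ) → (Fin d → ℤ) → ℝ}

theorem IsCavityBoundary.pos (hlam : 0 < lam) (hB : IsCavityBoundary d lam B) (X v) : 0 < B X v :=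
  lt_of_lt_of_le (by positivity) (hB X v).1

theorem isCavityBoundary_one (hlam : 0 < lam) : IsCavityBoundary d lam fun _ _ => 1 := by
  refine fun _ _ => ⟨?_, le_rfl⟩
  have : 0 ≤ 2 * lam * d := by positivity
  rw [div_le_one (by linarith)]
  linarith

theorem IsCavityBoundary.cavityValue (hlam : 0 < lam) (R : Set (Fin d → ℤ))
    (hB : IsCavityBoundary d lam B) (t : ℕ) : IsCavityBoundary d lam (cavityValue lam R B t) := by
  induction t with
  | zero => exact hB
  | succ t ih =>
    intro X v
    rw [_root_.cavityValue]
    have h0 : 0 ≤ ∑ e ∈ openSteps R X v, _root_.cavityValue lam R B t (v :: X) (v + e) :=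
      Finset.sum_nonneg fun e _ => (ih.pos hlam _ _).le
    have h1 : ∑ e ∈ openSteps R X v, _root_.cavityValue lam R B t (v :: X) (v + e) ≤
        (openSteps R X v).card := by
      refine (Finset.sum_le_card_nsmul _ _ 1 fun e _ => (ih _ _).2).trans (by simp)
    have h2 := card_openSteps_mul_le hlam R X v
    have h3 := mul_nonneg hlam.le h0
    refine ⟨one_div_le_one_div_of_le (by linarith) (by nlinarith), ?_⟩
    rw [div_le_one (by linarith)]
    linarith

/-- A deeper recursion is a shallower one with other boundary values, so comparing boundary values
also compares depths. -/
theorem cavityValue_add (m n : ℕ) (X : List (Fin d → ℤ)) (v : Fin d → ℤ) :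
    cavityValue lam R (cavityValue lam R B n) m X v = cavityValue lam R B (m + n) X v := by
  induction m generalizing X v with
  | zero => simp [cavityValue]
  | succ m ih =>
    rw [Nat.succ_add, cavityValue, cavityValue]
    simp only [ih]

/-- A boundary that is itself a solution of the recursion is reproduced at every depth. -/
theorem cavityValue_of_fixed
    (h : ∀ X, ∀ v ∈ R, v ∉ X → B X v = 1 / (1 + lam * ∑ e ∈ openSteps R X v, B (v :: X) (v + e)))
    (t : ℕ) {X : List (Fin d → ℤ)} {v : Fin d → ℤ} (hv : v ∈ R) (hX : v ∉ X) :
    cavityValue lam R B t X v = B X v := by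
  induction t generalizing X v with
  | zero => rfl
  | succ t ih =>
    rw [cavityValue, h X v hv hX]
    congr 3
    refine Finset.sum_congr rfl fun e he => ?_
    rw [mem_openSteps] at he
    exact ih he.2.1 he.2.2

/-- Induction two levels at a time. It starts at angle `φ` because `1 + 1/sinh² φ = 1 + 2λd` is the
largest possible ratio of two admissible boundary values. -/
theorem cavityValue_contraction (hlam : 0 < lam) {φ : ℝ} (hφ : 0 < φ)
    (hD : 2 * lam * d * Real.sinh φ ^ 2 = 1) (hB : IsCavityBoundary d lam B)
    (hB' : IsCavityBoundary d lam B') (k : ℕ) (X : List (Fin d → ℤ)) (v : Fin d → ℤ) :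
    Real.sinh ((k + 1) * φ) ^ 2 * cavityValue lam R B (2 * k) X v ≤
      (1 + Real.sinh ((k + 1) * φ) ^ 2) * cavityValue lam R B' (2 * k) X v := by
  have hs : 0 < Real.sinh φ := Real.sinh_pos_iff.2 hφ
  induction k generalizing X v with
  | zero =>
    simp only [CharP.cast_eq_zero, zero_add, one_mul, cavityValue]
    have h1 := (hB X v).2
    have h2 := (hB' X v).1
    have hDp : 0 ≤ 2 * lam * d := by positivity
    have h3 : Real.sinh φ ^ 2 ≤ (1 + Real.sinh φ ^ 2) * (1 / (1 + 2 * lam * d)) := by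
      rw [mul_one_div, le_div_iff₀ (by linarith)]
      nlinarith
    calc Real.sinh φ ^ 2 * B X v ≤ Real.sinh φ ^ 2 * 1 := by gcongr
      _ ≤ (1 + Real.sinh φ ^ 2) * (1 / (1 + 2 * lam * d)) := by rw [mul_one]; exact h3
      _ ≤ (1 + Real.sinh φ ^ 2) * B' X v := by gcongr
  | succ k ih =>
    have e : (((k + 1 : ℕ) : ℝ) + 1) * φ = (k + 1) * φ + φ := by push_cast; ring
    rw [e, show 2 * (k + 1) = (2 * k + 1) + 1 by ring, cavityValue, cavityValue]
    have hb := fun t => hB.cavityValue hlam R t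
    have hb' := fun t => hB'.cavityValue hlam R t
    refine cavity_ratio_outer hlam (card_openSteps_mul_le hlam R X v) hD
      (Real.sinh_pos_iff.2 (by positivity)) (fun e _ => ((hb _).pos hlam _ _).le)
      (fun e _ => ((hb' _).pos hlam _ _).le) (fun e _ => (hb' _ _ _).2) fun e _ => ?_
    rw [cavityValue, cavityValue]
    exact cavity_ratio_inner hlam (fun e _ => ((hb _).pos hlam _ _).le)
      (fun e _ => ((hb' _).pos hlam _ _).le) fun f _ => ih _ _

/-- The bound on the logarithmic error of the cavity recursion at depth `n`. -/
noncomputable def cavityError (d : ℕ) (lam : ℝ) (n : ℕ) : ℝ :=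
  1 / Real.sinh ((n + 1) / (2 * Real.sqrt (1 + 2 * lam * d))) ^ 2

theorem one_lt_sqrt_scale (hd : 0 < d) (hlam : 0 < lam) : 1 < Real.sqrt (1 + 2 * lam * d) := by
  rw [Real.lt_sqrt (by norm_num)]
  have : (0 : ℝ) < d := by exact_mod_cast hd
  have : 0 < 2 * lam * d := by positivity
  linarith

theorem log_cavityValue_sub_le (hd : 0 < d) (hlam : 0 < lam) (hB : IsCavityBoundary d lam B)
    (hB' : IsCavityBoundary d lam B') (n : ℕ) (X : List (Fin d → ℤ)) (v : Fin d → ℤ) :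
    Real.log (cavityValue lam R B n X v) - Real.log (cavityValue lam R B' n X v) ≤
      cavityError d lam n := by
  have hs := one_lt_sqrt_scale hd hlam
  set s := Real.sqrt (1 + 2 * lam * d) with hsdef
  have hdp : (0 : ℝ) < d := by exact_mod_cast hd
  have hDp : 0 < 2 * lam * d := by positivity
  have hs2 : s ^ 2 = 1 + 2 * lam * d := Real.sq_sqrt (by linarith)
  have hmem : 1 / s ∈ Set.Ioo (-1 : ℝ) 1 := by
    refine ⟨by have : 0 < 1 / s := by positivity
               linarith, ?_⟩
    rw [div_lt_one (by linarith)]; exact hs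
  -- The condition `2λd sinh² φ = 1` is equivalent, for `φ > 0`, to `tanh φ = 1/s`.
  set φ := Real.artanh (1 / s) with hφ
  have hφpos : 0 < φ := Real.artanh_pos ⟨by positivity, hmem.2⟩
  have hφs : 1 / s ≤ φ := by
    have := Real.tanh_le_self hφpos.le
    rwa [hφ, Real.tanh_artanh hmem] at this
  have hD : 2 * lam * d * Real.sinh φ ^ 2 = 1 := by
    have h1 : 0 < 1 - (1 / s) ^ 2 := by
      have := hmem.2
      have h0 : 0 < 1 / s := by positivity
      nlinarith
    rw [hφ, Real.sinh_artanh hmem, div_pow, Real.sq_sqrt h1.le,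
      show 2 * lam * d = s ^ 2 - 1 by linarith]
    have : s ^ 2 - 1 ≠ 0 := by linarith
    field_simp
  -- The contraction treats even depths; the odd level, if any, is absorbed into the boundary
  -- values.
  obtain ⟨r, hr⟩ : ∃ r, n = 2 * (n / 2) + r := ⟨n % 2, by omega⟩
  have key := cavityValue_contraction (R := R) hlam hφpos hD (hB.cavityValue hlam R r)
    (hB'.cavityValue hlam R r) (n / 2) X v
  rw [cavityValue_add, cavityValue_add, ← hr] at key
  set W := Real.sinh ((((n / 2 : ℕ) : ℝ) + 1) * φ) ^ 2
  have harg : (n + 1) / (2 * s) ≤ (((n / 2 : ℕ) : ℝ) + 1) * φ := by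
    have h1 : (n : ℝ) ≤ 2 * (n / 2 : ℕ) + 1 := by exact_mod_cast (by omega : n ≤ 2 * (n / 2) + 1)
    calc (n + 1) / (2 * s) = (n + 1) / 2 * (1 / s) := by field_simp
      _ ≤ (((n / 2 : ℕ) : ℝ) + 1) * φ := by gcongr; linarith
  have hs0 : 0 < Real.sinh ((n + 1) / (2 * s)) := Real.sinh_pos_iff.2 (by positivity)
  have hW : Real.sinh ((n + 1) / (2 * s)) ^ 2 ≤ W := by
    exact pow_le_pow_left₀ hs0.le (Real.sinh_le_sinh.2 harg) 2
  have hWp : 0 < W := lt_of_lt_of_le (by positivity) hW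
  have hp := (hB.cavityValue hlam R n).pos hlam X v
  have hp' := (hB'.cavityValue hlam R n).pos hlam X v
  rw [← Real.log_div hp.ne' hp'.ne']
  refine (Real.log_le_sub_one_of_pos (by positivity)).trans ?_
  refine le_trans ?_ (one_div_le_one_div_of_le (by positivity) hW)
  rw [sub_le_iff_le_add, div_le_iff₀ hp', ← mul_le_mul_iff_right₀ hWp]
  refine key.trans (le_of_eq ?_)
  field_simp

theorem abs_log_cavityValue_sub_le (hd : 0 < d) (hlam : 0 < lam) (hB : IsCavityBoundary d lam B)
    (hB' : IsCavityBoundary d lam B') (n : ℕ) (X : List (Fin d → ℤ)) (v : Fin d → ℤ) :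
    |Real.log (cavityValue lam R B n X v) - Real.log (cavityValue lam R B' n X v)| ≤
      cavityError d lam n :=
  abs_sub_le_iff.2 ⟨log_cavityValue_sub_le hd hlam hB hB' n X v,
    log_cavityValue_sub_le hd hlam hB' hB n X v⟩

theorem cavityError_nonneg (n : ℕ) : 0 ≤ cavityError d lam n := by
  rw [cavityError]; positivity

/-- The bound decays exponentially. -/
theorem exists_cavityError_le (hd : 0 < d) (hlam : 0 < lam) :
    ∃ K q : ℝ, 0 < K ∧ 0 < q ∧ q < 1 ∧ ∀ n, cavityError d lam n ≤ K * q ^ (2 * n) := by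
  have hs := one_lt_sqrt_scale hd hlam
  set s := Real.sqrt (1 + 2 * lam * d) with hsdef
  have hx0 : Real.exp (-(1 / s)) < 1 := Real.exp_lt_one_iff.2 (by rw [neg_lt_zero]; positivity)
  -- Since `x ≥ 1/(2s)` below, `exp(-x) ≤ exp(-1/s) exp x`, hence `sinh x ≥ (c/2) exp x`. The rate
  -- is written `q^(2n)` so that for distances `m ≤ n` to two faces it is at most `q^m q^n`.
  set c := 1 - Real.exp (-(1 / s)) with hc
  have hcp : 0 < c := by linarith
  refine ⟨4 / c ^ 2, Real.exp (-(1 / (2 * s))), by positivity, Real.exp_pos _,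
    Real.exp_lt_one_iff.2 (by rw [neg_lt_zero]; positivity), fun n => ?_⟩
  rw [cavityError, ← hsdef]
  set x := ((n : ℝ) + 1) / (2 * s) with hx
  have hsinh : c / 2 * Real.exp x ≤ Real.sinh x := by
    have : Real.exp (-x) ≤ Real.exp (-(1 / s)) * Real.exp x := by
      rw [← Real.exp_add, Real.exp_le_exp]
      have : 1 / s ≤ 2 * x := by
        rw [hx, div_le_iff₀ (by linarith)]
        have : (0 : ℝ) ≤ n := by positivity
        field_simp
        linarith
      linarith
    rw [Real.sinh_eq, hc]
    linarith
  have e : 4 / c ^ 2 * Real.exp (-(1 / (2 * s))) ^ (2 * n) = 1 / (c / 2 * Real.exp (n / (2 * s))) ^ 2 := by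
    rw [← Real.exp_nat_mul, mul_pow, ← Real.exp_nat_mul,
      show ((2 * n : ℕ) : ℝ) * -(1 / (2 * s)) = -((2 : ℕ) * (n / (2 * s))) by push_cast; ring,
      Real.exp_neg]
    field_simp
    norm_num
  rw [e]
  refine one_div_le_one_div_of_le (by positivity) ?_
  have : Real.exp (n / (2 * s)) ≤ Real.exp x := by
    rw [Real.exp_le_exp, hx]; gcongr; linarith
  gcongr
  exact (mul_le_mul_of_nonneg_left this (by positivity)).trans hsinh

/-- The form with explicit constants, for the accuracy of the algorithm: `hn` puts the argument `x`
of `sinh` above `1`, where `sinh x ≥ exp x / 4`. -/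
theorem cavityError_le_exp (n : ℕ) (hn : 2 * Real.sqrt (1 + 2 * lam * d) ≤ n)
    (hs : 0 < Real.sqrt (1 + 2 * lam * d)) :
    cavityError d lam n ≤ 16 * Real.exp (-((n + 1) / Real.sqrt (1 + 2 * lam * d))) := by
  rw [cavityError]
  set s := Real.sqrt (1 + 2 * lam * d)
  set x := ((n : ℝ) + 1) / (2 * s) with hx
  have hx1 : 1 ≤ x := by
    rw [hx, le_div_iff₀ (by linarith)]; linarith
  have h2 : Real.exp x / 4 ≤ Real.sinh x := by
    rw [Real.sinh_eq]
    have h1 : Real.exp (-x) ≤ 1 := Real.exp_le_one_iff.2 (by linarith)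
    have h2 : 2 ≤ Real.exp x := by
      have := Real.add_one_le_exp x
      linarith
    linarith
  have e : 16 * Real.exp (-((n + 1) / s)) = 1 / (Real.exp x / 4) ^ 2 := by
    rw [show ((n : ℝ) + 1) / s = (2 : ℕ) * x by rw [hx]; push_cast; field_simp, Real.exp_neg,
      Real.exp_nat_mul]
    field_simp
    norm_num
  rw [e]
  refine one_div_le_one_div_of_le (by positivity) ?_
  gcongr

theorem tendsto_cavityError (hd : 0 < d) (hlam : 0 < lam) :
    Filter.Tendsto (cavityError d lam) Filter.atTop (𝓝 0) := by
  obtain ⟨K, q, _, hq, hq1, h⟩ := exists_cavityError_le hd hlam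
  refine squeeze_zero (fun n => cavityError_nonneg n) h ?_
  have := (tendsto_pow_atTop_nhds_zero_of_lt_one (r := q ^ 2) (by positivity)
    (by nlinarith)).const_mul K
  simpa [pow_mul] using this

/-! ### Locality and limits -/

/-- The sets `R` near `v` and `R'` near `v + w` agree after translation, up to `t` unit steps. -/
def AgreeWithin (R R' : Set (Fin d → ℤ)) (w : Fin d → ℤ) : ℕ → (Fin d → ℤ) → Prop
  | 0, _ => True
  | t + 1, v => ∀ e ∈ unitSteps d, (v + e ∈ R ↔ v + e + w ∈ R') ∧ AgreeWithin R R' w t (v + e)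

/-- Depth `t` inspects only vertices reachable in `t` steps. The boundary values are constant
because general ones need not be translation invariant. -/
theorem cavityValue_eq_of_agreeWithin {R' : Set (Fin d → ℤ)} {w : Fin d → ℤ} {c : ℝ} {t : ℕ}
    {v : Fin d → ℤ} (h : AgreeWithin R R' w t v) (X : List (Fin d → ℤ)) :
    cavityValue lam R (fun _ _ => c) t X v =
      cavityValue lam R' (fun _ _ => c) t (X.map (· + w)) (v + w) := by
  induction t generalizing X v with
  | zero => rfl
  | succ t ih =>
    rw [cavityValue, cavityValue]
    have hmem : ∀ e, v + e + w ∈ (v + w) :: X.map (· + w) ↔ v + e ∈ v :: X := by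
      intro e
      rw [← List.map_cons (f := (· + w)), List.mem_map_of_injective (add_left_injective w)]
    have hsteps : openSteps R' (X.map (· + w)) (v + w) = openSteps R X v := by
      ext e
      rw [mem_openSteps, mem_openSteps, add_right_comm, hmem]
      exact and_congr_right fun he => by rw [(h e he).1]
    rw [hsteps]
    congr 3
    refine Finset.sum_congr rfl fun e he => ?_
    rw [ih (h e (mem_openSteps.1 he).1).2, List.map_cons, add_right_comm]

theorem abs_le_one_of_mem_unitSteps {e : Fin d → ℤ} (he : e ∈ unitSteps d) (i : Fin d) :
    |e i| ≤ 1 := by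
  simp only [unitSteps, List.mem_flatMap, List.mem_finRange, true_and, List.mem_cons,
    List.not_mem_nil, or_false] at he
  obtain ⟨j, rfl | rfl⟩ := he <;> by_cases hij : i = j <;> simp [hij]

/-- Agreement on a cube implies agreement within as many steps. -/
theorem agreeWithin_of_cube {R' : Set (Fin d → ℤ)} {w : Fin d → ℤ} {t : ℕ} {v : Fin d → ℤ}
    (h : ∀ u : Fin d → ℤ, (∀ i, |u i - v i| ≤ t) → (u ∈ R ↔ u + w ∈ R')) :
    AgreeWithin R R' w t v := by
  induction t generalizing v with
  | zero => trivial
  | succ t ih =>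
    intro e he
    have h1 := abs_le_one_of_mem_unitSteps he
    refine ⟨h _ fun i => ?_, ih fun u hu => h u fun i => ?_⟩
    · have := h1 i
      simp only [Pi.add_apply, add_sub_cancel_left]
      push_cast
      omega
    · have h2 := h1 i
      have h3 := hu i
      simp only [Pi.add_apply] at h3
      rw [abs_le] at *
      push_cast
      constructor <;> omega

/-- The limit of the logarithm of the cavity recursion at the origin. -/
noncomputable def logCavityLimit (lam : ℝ) (R : Set (Fin d → ℤ)) : ℝ :=
  Filter.limUnder Filter.atTop fun t => Real.log (cavityValue lam R (fun _ _ => 1) t [] 0)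

/-- The value at depth `n ≥ t` is a depth-`t` value with other admissible boundary values, so the
sequence is Cauchy with rate `cavityError`. -/
theorem abs_log_cavityValue_sub_limit_le (hd : 0 < d) (hlam : 0 < lam) (R : Set (Fin d → ℤ))
    (t : ℕ) :
    |Real.log (cavityValue lam R (fun _ _ => 1) t [] 0) - logCavityLimit lam R| ≤
      cavityError d lam t := by
  have hone := isCavityBoundary_one (d := d) hlam
  have hstep : ∀ m n, m ≤ n → |Real.log (cavityValue lam R (fun _ _ => 1) m [] 0) -
      Real.log (cavityValue lam R (fun _ _ => 1) n [] 0)| ≤ cavityError d lam m := by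
    intro m n hmn
    obtain ⟨k, rfl⟩ := Nat.exists_eq_add_of_le hmn
    rw [← cavityValue_add]
    exact abs_log_cavityValue_sub_le hd hlam hone (hone.cavityValue hlam R k) m [] 0
  have hcauchy : CauchySeq fun t => Real.log (cavityValue lam R (fun _ _ => 1) t [] 0) := by
    refine cauchySeq_of_le_tendsto_0' (cavityError d lam) (fun m n h => ?_)
      (tendsto_cavityError hd hlam)
    rw [Real.dist_eq]
    exact hstep m n h
  have hlim := hcauchy.tendsto_limUnder
  refine le_of_tendsto ((tendsto_const_nhds.sub hlim).abs) ?_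
  filter_upwards [Filter.eventually_ge_atTop t] with n hn
  exact hstep t n hn

theorem log_cavityValue_mem (hlam : 0 < lam) (hB : IsCavityBoundary d lam B) (n : ℕ)
    (X : List (Fin d → ℤ)) (v : Fin d → ℤ) :
    |Real.log (cavityValue lam R B n X v)| ≤ Real.log (1 + 2 * lam * d) := by
  obtain ⟨h1, h2⟩ := hB.cavityValue hlam R n X v
  have h0 := (hB.cavityValue hlam R n).pos hlam X v
  rw [abs_of_nonpos (Real.log_nonpos h0.le h2), neg_le, ← Real.log_inv, ← one_div]
  exact Real.log_le_log (by positivity) h1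

end

/-! ### The recursion for the partition function -/

theorem mem_unitSteps_iff {e : Fin d → ℤ} : e ∈ unitSteps d ↔ ∑ i, |e i| = 1 := by
  simp only [unitSteps, List.mem_flatMap, List.mem_finRange, true_and, List.mem_cons,
    List.not_mem_nil, or_false]
  constructor
  · rintro ⟨i, rfl | rfl⟩
    · rw [Finset.sum_eq_single i (fun j _ hj => by simp [hj]) (by simp)]; simp
    · rw [Finset.sum_eq_single i (fun j _ hj => by simp [hj]) (by simp)]; simp
  · intro h
    obtain ⟨i, -, hi⟩ := Finset.exists_ne_zero_of_sum_ne_zero (h.trans_ne one_ne_zero)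
    have hsplit := Finset.add_sum_erase Finset.univ (fun j => |e j|) (Finset.mem_univ i)
    have hnn : 0 ≤ ∑ j ∈ Finset.univ.erase i, |e j| := Finset.sum_nonneg fun _ _ => abs_nonneg _
    have hpos : 0 < |e i| := lt_of_le_of_ne (abs_nonneg _) (Ne.symm hi)
    simp only [h] at hsplit
    have hzero : ∑ j ∈ Finset.univ.erase i, |e j| = 0 := by omega
    have hei : |e i| = 1 := by omega
    rw [Finset.sum_eq_zero_iff_of_nonneg fun _ _ => abs_nonneg _] at hzero
    have hz : ∀ j, j ≠ i → e j = 0 := fun j hj => abs_eq_zero.1 (hzero j (by simp [hj]))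
    refine ⟨i, ?_⟩
    rcases (abs_eq zero_le_one).1 hei with h1 | h1
    · left; funext j
      by_cases hj : j = i
      · subst hj; simp [h1]
      · simp [hj, hz j hj]
    · right; funext j
      by_cases hj : j = i
      · subst hj; simp [h1]
      · simp [hj, hz j hj]

theorem latticeGraph_adj_add_iff {v e : Fin d → ℤ} :
    (latticeGraph d).Adj v (v + e) ↔ e ∈ unitSteps d := by
  rw [mem_unitSteps_iff]
  simp [latticeGraph]

open Classical in
/-- The matchings of the subgraph of `ℤ^d` induced by `S`. -/
noncomputable def matchings (S : Finset (Fin d → ℤ)) : Finset (Finset (Sym2 (Fin d → ℤ))) :=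
  S.sym2.powerset.filter fun M => IsMatchingSet (latticeGraph d) M

theorem mem_matchings {S : Finset (Fin d → ℤ)} {M : Finset (Sym2 (Fin d → ℤ))} :
    M ∈ matchings S ↔ (∀ e ∈ M, ∀ a ∈ e, a ∈ S) ∧ IsMatchingSet (latticeGraph d) M := by
  simp [matchings, Finset.subset_iff, Finset.mem_sym2_iff]

theorem partitionFunction_eq (lam : ℝ) (S : Finset (Fin d → ℤ)) :
    partitionFunction d lam S = ∑ M ∈ matchings S, lam ^ M.card := rfl

theorem matchings_mono {S T : Finset (Fin d → ℤ)} (h : S ⊆ T) : matchings S ⊆ matchings T := by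
  intro M hM
  rw [mem_matchings] at *
  exact ⟨fun e he a ha => h (hM.1 e he a ha), hM.2⟩

theorem empty_mem_matchings (S : Finset (Fin d → ℤ)) : ∅ ∈ matchings S := by
  simp [mem_matchings, IsMatchingSet]

theorem partitionFunction_mono {lam : ℝ} (hlam : 0 < lam) {S T : Finset (Fin d → ℤ)} (h : S ⊆ T) :
    partitionFunction d lam S ≤ partitionFunction d lam T := by
  rw [partitionFunction_eq, partitionFunction_eq]
  exact Finset.sum_le_sum_of_subset_of_nonneg (matchings_mono h) fun _ _ _ => by positivity

theorem partitionFunction_pos {lam : ℝ} (hlam : 0 < lam) (S : Finset (Fin d → ℤ)) :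
    0 < partitionFunction d lam S := by
  rw [partitionFunction_eq]
  exact Finset.sum_pos (fun _ _ => by positivity) ⟨∅, empty_mem_matchings S⟩

theorem partitionFunction_empty (lam : ℝ) : partitionFunction d lam ∅ = 1 := by
  rw [partitionFunction_eq]
  have : matchings (∅ : Finset (Fin d → ℤ)) = {∅} := by
    ext M
    rw [mem_matchings, Finset.mem_singleton]
    constructor
    · rintro ⟨h, -⟩
      refine Finset.eq_empty_of_forall_notMem fun e he => ?_
      induction e using Sym2.ind with
      | _ a b => simpa using h _ he a (by simp)
    · rintro rfl; simp [IsMatchingSet]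
  simp [this]

theorem insert_mem_matchings {S : Finset (Fin d → ℤ)} {v u : Fin d → ℤ} (hv : v ∈ S) (hu : u ∈ S)
    (huv : (latticeGraph d).Adj v u) [DecidableEq (Sym2 (Fin d → ℤ))]
    {M : Finset (Sym2 (Fin d → ℤ))} (hM : M ∈ matchings ((S.erase v).erase u)) :
    insert s(v, u) M ∈ matchings S := by
  rw [mem_matchings] at *
  obtain ⟨h1, h2, h3⟩ := hM
  refine ⟨fun e he a ha => ?_, fun e he => ?_, fun e he f hf hef a hae haf => ?_⟩
  · rcases Finset.mem_insert.1 he with rfl | he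
    · rcases Sym2.mem_iff.1 ha with rfl | rfl <;> assumption
    · exact Finset.mem_of_mem_erase (Finset.mem_of_mem_erase (h1 e he a ha))
  · rcases Finset.mem_insert.1 he with rfl | he
    · exact huv
    · exact h2 e he
  · rcases Finset.mem_insert.1 he with rfl | he <;> rcases Finset.mem_insert.1 hf with rfl | hf
    · exact hef rfl
    · have := h1 f hf a haf
      rcases Sym2.mem_iff.1 hae with rfl | rfl <;> simp at this
    · have := h1 e he a hae
      rcases Sym2.mem_iff.1 haf with rfl | rfl <;> simp at this
    · exact h3 e he f hf hef a hae haf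

theorem notMem_of_mem_matchings_erase {S : Finset (Fin d → ℤ)} {v : Fin d → ℤ}
    {M : Finset (Sym2 (Fin d → ℤ))} (hM : M ∈ matchings (S.erase v)) {e : Sym2 (Fin d → ℤ)}
    (he : v ∈ e) : e ∉ M := fun h => by
  simpa using (mem_matchings.1 hM).1 e h v he

-- Either `v` is unmatched, or removing its edge to `u` leaves a matching, smaller by one edge, that
-- avoids both `v` and `u`.
open Classical in
theorem partitionFunction_recursion (lam : ℝ) {S : Finset (Fin d → ℤ)} {v : Fin d → ℤ}
    (hv : v ∈ S) :
    partitionFunction d lam S = partitionFunction d lam (S.erase v) +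
      lam * ∑ u ∈ S.filter fun u => (latticeGraph d).Adj v u,
        partitionFunction d lam ((S.erase v).erase u) := by
  have hsplit := Finset.sum_filter_add_sum_filter_not (matchings S) (fun M => ∀ e ∈ M, v ∉ e)
    fun M => lam ^ M.card
  rw [partitionFunction_eq, ← hsplit]
  congr 1
  · rw [partitionFunction_eq]
    refine Finset.sum_congr ?_ fun _ _ => rfl
    ext M
    simp only [Finset.mem_filter, mem_matchings, Finset.mem_erase]
    constructor
    · rintro ⟨⟨h1, h2⟩, h3⟩
      exact ⟨fun e he a ha => ⟨fun h => h3 e he (h ▸ ha), h1 e he a ha⟩, h2⟩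
    · rintro ⟨h1, h2⟩
      exact ⟨⟨fun e he a ha => (h1 e he a ha).2, h2⟩, fun e he ha => (h1 e he v ha).1 rfl⟩
  · simp only [partitionFunction_eq]
    rw [Finset.mul_sum]
    simp only [Finset.mul_sum]
    rw [Finset.sum_sigma']
    symm
    have hnot : ∀ u, ∀ M ∈ matchings ((S.erase v).erase u), ∀ e, v ∈ e → e ∉ M := fun u M hM e he =>
      notMem_of_mem_matchings_erase (matchings_mono (Finset.erase_subset _ _) hM) he
    refine Finset.sum_bij (fun x _ => insert s(v, x.1) x.2) ?_ ?_ ?_ ?_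
    · rintro ⟨u, M⟩ h
      simp only [Finset.mem_sigma, Finset.mem_filter] at h ⊢
      refine ⟨insert_mem_matchings hv h.1.1 h.1.2 h.2, fun h' => ?_⟩
      exact h' s(v, u) (Finset.mem_insert_self _ _) (by simp)
    · rintro ⟨u, M⟩ h ⟨u', M'⟩ h' heq
      simp only [Finset.mem_sigma, Finset.mem_filter] at h h' heq
      have hmem : s(v, u) ∈ insert s(v, u') M' := heq ▸ Finset.mem_insert_self _ _
      rcases Finset.mem_insert.1 hmem with h1 | h1
      · obtain rfl : u = u' := Sym2.congr_right.1 h1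
        have e1 := Finset.erase_insert (hnot u M h.2 s(v, u) (by simp))
        have e2 := Finset.erase_insert (hnot u M' h'.2 s(v, u) (by simp))
        rw [← e1, ← e2, heq]
      · exact absurd h1 (hnot u' M' h'.2 s(v, u) (by simp))
    · intro M hM
      simp only [Finset.mem_filter, not_forall, not_not] at hM
      obtain ⟨hM, e, he, hve⟩ := hM
      obtain ⟨u, rfl⟩ := hve
      obtain ⟨h1, h2, h3⟩ := mem_matchings.1 hM
      refine ⟨⟨u, M.erase s(v, u)⟩, ?_, Finset.insert_erase he⟩
      simp only [Finset.mem_sigma, Finset.mem_filter]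
      refine ⟨⟨h1 _ he u (by simp), h2 _ he⟩, mem_matchings.2 ⟨fun f hf a ha => ?_, ?_, ?_⟩⟩
      · obtain ⟨hne, hf⟩ := Finset.mem_erase.1 hf
        have hn : a ∉ s(v, u) := h3 f hf _ he hne a ha
        simp only [Sym2.mem_iff, not_or] at hn
        simp [hn.1, hn.2, h1 f hf a ha]
      · exact fun f hf => h2 f (Finset.mem_of_mem_erase hf)
      · exact fun f hf g hg => h3 f (Finset.mem_of_mem_erase hf) g (Finset.mem_of_mem_erase hg)
    · rintro ⟨u, M⟩ h
      simp only [Finset.mem_sigma] at h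
      rw [Finset.card_insert_of_notMem (hnot u M h.2 s(v, u) (by simp)), pow_succ']

/-! ### Monomer probabilities -/

open Classical in
/-- The probability that `v` is not matched in the subgraph induced by `S` without the list `X`. -/
noncomputable def monomerProb (lam : ℝ) (S : Finset (Fin d → ℤ)) (X : List (Fin d → ℤ))
    (v : Fin d → ℤ) : ℝ :=
  partitionFunction d lam (S \ (v :: X).toFinset) / partitionFunction d lam (S \ X.toFinset)

/-- Dividing the recursion for the partition function by its value without `v` gives the reciprocal
of the left side; each quotient in the sum is a neighbour's monomer probability after `v` has joined
the list. -/
theorem monomerProb_fixed {lam : ℝ} (hlam : 0 < lam) (S : Finset (Fin d → ℤ))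
    {X : List (Fin d → ℤ)} {v : Fin d → ℤ} (hv : v ∈ S) (hX : v ∉ X) :
    monomerProb lam S X v =
      1 / (1 + lam * ∑ e ∈ openSteps (S : Set (Fin d → ℤ)) X v,
        monomerProb lam S (v :: X) (v + e)) := by
  classical
  have herase : ∀ (u : Fin d → ℤ) (Y : List (Fin d → ℤ)),
      S \ (u :: Y).toFinset = (S \ Y.toFinset).erase u := fun u Y => by
    ext x; simp only [List.toFinset_cons, Finset.mem_sdiff, Finset.mem_insert, Finset.mem_erase]
    tauto
  have hrec := partitionFunction_recursion lam (S := S \ X.toFinset) (v := v) (by simp [hv, hX])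
  have hsum : ∑ e ∈ openSteps (S : Set (Fin d → ℤ)) X v,
      partitionFunction d lam (((S \ X.toFinset).erase v).erase (v + e)) =
      ∑ u ∈ (S \ X.toFinset).filter fun u => (latticeGraph d).Adj v u,
        partitionFunction d lam (((S \ X.toFinset).erase v).erase u) := by
    refine Finset.sum_bij (fun e _ => v + e) (fun e he => ?_) (fun e _ f _ h => add_left_cancel h)
      (fun u hu => ?_) (fun _ _ => rfl)
    · rw [mem_openSteps] at he
      simp only [Finset.mem_filter, Finset.mem_sdiff, List.mem_toFinset, latticeGraph_adj_add_iff]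
      exact ⟨⟨he.2.1, fun h => he.2.2 (List.mem_cons_of_mem _ h)⟩, he.1⟩
    · simp only [Finset.mem_filter, Finset.mem_sdiff, List.mem_toFinset] at hu
      obtain ⟨e, rfl⟩ : ∃ e, u = v + e := ⟨u - v, by abel⟩
      refine ⟨e, mem_openSteps.2 ⟨latticeGraph_adj_add_iff.1 hu.2, hu.1.1, ?_⟩, rfl⟩
      rw [List.mem_cons, not_or]
      exact ⟨hu.2.ne', hu.1.2⟩
  have hp := partitionFunction_pos hlam ((S \ X.toFinset).erase v)
  have hp' := partitionFunction_pos hlam (S \ X.toFinset)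
  simp only [monomerProb, herase]
  rw [← Finset.sum_div, hsum, ← one_div_div]
  congr 1
  rw [hrec, add_div, div_self hp.ne', mul_div_assoc]

theorem isCavityBoundary_monomerProb {lam : ℝ} (hlam : 0 < lam) (S : Finset (Fin d → ℤ)) :
    IsCavityBoundary d lam (monomerProb lam S) := by
  classical
  intro X v
  have hone := isCavityBoundary_one (d := d) hlam X v
  by_cases hv : v ∈ S ∧ v ∉ X
  · have hle : ∀ Y u, 0 ≤ monomerProb lam S Y u ∧ monomerProb lam S Y u ≤ 1 := fun Y u => by
      have hp := partitionFunction_pos hlam (S \ (u :: Y).toFinset)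
      have hp' := partitionFunction_pos hlam (S \ Y.toFinset)
      refine ⟨by rw [monomerProb]; positivity, ?_⟩
      rw [monomerProb, div_le_one hp']
      refine partitionFunction_mono hlam (Finset.sdiff_subset_sdiff le_rfl ?_)
      rw [List.toFinset_cons]; exact Finset.subset_insert _ _
    refine ⟨?_, (hle X v).2⟩
    rw [monomerProb_fixed hlam S hv.1 hv.2]
    have h0 : 0 ≤ ∑ e ∈ openSteps (S : Set (Fin d → ℤ)) X v, monomerProb lam S (v :: X) (v + e) :=
      Finset.sum_nonneg fun e _ => (hle _ _).1
    have h1 : ∑ e ∈ openSteps (S : Set (Fin d → ℤ)) X v, monomerProb lam S (v :: X) (v + e) ≤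
        (openSteps (S : Set (Fin d → ℤ)) X v).card :=
      (Finset.sum_le_card_nsmul _ _ 1 fun e _ => (hle _ _).2).trans (by simp)
    have h2 := card_openSteps_mul_le hlam (S : Set (Fin d → ℤ)) X v
    have h3 := mul_nonneg hlam.le h0
    exact one_div_le_one_div_of_le (by linarith) (by nlinarith)
  -- Boundary values are constrained at all arguments. Here `v` is absent already, so deleting it
  -- changes nothing.
  · have : monomerProb lam S X v = 1 := by
      have hS : S \ (v :: X).toFinset = S \ X.toFinset := by
        ext x
        simp only [List.toFinset_cons, Finset.mem_sdiff, Finset.mem_insert, List.mem_toFinset]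
        constructor
        · tauto
        · rintro ⟨h1, h2⟩
          refine ⟨h1, fun h => h.elim (fun h => hv ⟨h ▸ h1, h ▸ h2⟩) h2⟩
      rw [monomerProb, hS, div_self (partitionFunction_pos hlam _).ne']
    rw [this]; exact hone

/-! ### Sequential decomposition of the partition function -/

theorem lexPrec_iff_toColex {u v : Fin d → ℤ} : lexPrec u v ↔ toColex u < toColex v := by
  refine exists_congr fun k => ?_
  rw [and_comm]
  rfl

theorem lexPrec_sub_iff {u v : Fin d → ℤ} : lexPrec (u - v) 0 ↔ lexPrec u v := by
  simp [lexPrec, sub_eq_zero]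

open Classical in
/-- The vertices of `S` that precede `v` or are equal to it. -/
noncomputable def lexBelow (S : Finset (Fin d → ℤ)) (v : Fin d → ℤ) : Finset (Fin d → ℤ) :=
  S.filter fun u => lexPrec u v ∨ u = v

theorem mem_lexBelow {S : Finset (Fin d → ℤ)} {u v : Fin d → ℤ} :
    u ∈ lexBelow S v ↔ u ∈ S ∧ u - v ∈ cavityHalf d := by
  simp [lexBelow, cavityHalf, lexPrec_sub_iff, sub_eq_zero]

/-- For the largest vertex `v`, the set `lexBelow S v` is all of `S`, so its term is the logarithm
of the quotient of the partition functions of `S` and `S - v`. Deleting `v` does not alter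
`lexBelow` at the other vertices. The type synonym `Colex` supplies the linear order for the
induction. -/
theorem log_partitionFunction_eq_sum {lam : ℝ} (hlam : 0 < lam) (S : Finset (Fin d → ℤ)) :
    Real.log (partitionFunction d lam S) =
      ∑ v ∈ S, -Real.log (monomerProb lam (lexBelow S v) [] v) := by
  classical
  suffices H : ∀ T : Finset (Colex (Fin d → ℤ)), ∀ S : Finset (Fin d → ℤ),
      S = T.map (ofColex (α := Fin d → ℤ)).toEmbedding →
      Real.log (partitionFunction d lam S) =
        ∑ v ∈ S, -Real.log (monomerProb lam (lexBelow S v) [] v) from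
    H (S.map (toColex (α := Fin d → ℤ)).toEmbedding) S (by ext; simp)
  intro T
  induction T using Finset.induction_on_max with
  | empty => rintro S rfl; simp [partitionFunction_empty]
  | insert a T hmax ih =>
    intro S hS
    set S' := T.map (ofColex (α := Fin d → ℤ)).toEmbedding with hS'
    set v : Fin d → ℤ := ofColex a with hva
    have hSS : S = insert v S' := by
      rw [hS, Finset.map_insert]; rfl
    have hlt : ∀ u ∈ S', lexPrec u v := by
      intro u hu
      obtain ⟨b, hb, rfl⟩ := Finset.mem_map.1 hu
      exact lexPrec_iff_toColex.2 (hmax b hb)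
    have hnot : ∀ u ∈ S', ¬ (lexPrec v u ∨ v = u) := by
      intro u hu h
      have h1 := lexPrec_iff_toColex.1 (hlt u hu)
      rcases h with h | h
      · exact lt_asymm h1 (lexPrec_iff_toColex.1 h)
      · exact absurd h1 (h ▸ lt_irrefl _)
    have hv : v ∉ S' := fun h => hnot v h (Or.inr rfl)
    have hbelow : lexBelow S v = S := by
      ext x
      simp only [lexBelow, Finset.mem_filter, and_iff_left_iff_imp, hSS, Finset.mem_insert]
      rintro (rfl | h)
      · exact Or.inr rfl
      · exact Or.inl (hlt x h)
    have hbelow' : ∀ u ∈ S', lexBelow S u = lexBelow S' u := by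
      intro u hu
      ext x
      simp only [lexBelow, Finset.mem_filter, hSS, Finset.mem_insert]
      constructor
      · rintro ⟨rfl | h, h'⟩
        · exact absurd h' (hnot u hu)
        · exact ⟨h, h'⟩
      · exact fun h => ⟨Or.inr h.1, h.2⟩
    have herase : S \ [v].toFinset = S' := by
      rw [hSS]; ext x; simp only [List.toFinset_cons, List.toFinset_nil, Finset.mem_sdiff,
        Finset.mem_insert, Finset.notMem_empty, or_false]
      constructor
      · tauto
      · exact fun h => ⟨Or.inr h, fun hx => hv (hx ▸ h)⟩
    have hsum : ∑ u ∈ S, -Real.log (monomerProb lam (lexBelow S u) [] u) =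
        -Real.log (monomerProb lam S [] v) +
          ∑ u ∈ S', -Real.log (monomerProb lam (lexBelow S' u) [] u) := by
      conv_lhs => rw [hSS]
      rw [Finset.sum_insert hv, ← hSS, hbelow]
      congr 1
      exact Finset.sum_congr rfl fun u hu => by rw [hbelow' u hu]
    rw [hsum, ← ih S' hS', monomerProb, herase, List.toFinset_nil, Finset.sdiff_empty,
      Real.log_div (partitionFunction_pos hlam _).ne' (partitionFunction_pos hlam _).ne']
    ring

theorem cavityValue_monomerProb {lam : ℝ} (hlam : 0 < lam) (S : Finset (Fin d → ℤ)) (n : ℕ)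
    {v : Fin d → ℤ} (hv : v ∈ S) :
    cavityValue lam (S : Set (Fin d → ℤ)) (monomerProb lam S) n [] v = monomerProb lam S [] v := by
  have hfix : ∀ X, ∀ u ∈ (S : Set (Fin d → ℤ)), u ∉ X → monomerProb lam S X u =
      1 / (1 + lam * ∑ e ∈ openSteps (S : Set (Fin d → ℤ)) X u,
        monomerProb lam S (u :: X) (u + e)) :=
    fun X u hu hX => monomerProb_fixed hlam S (Finset.mem_coe.1 hu) hX
  exact cavityValue_of_fixed hfix n (Finset.mem_coe.2 hv) List.not_mem_nil

/-- Near a vertex where the region looks like `R`, the monomer probability is close to its value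
in `R`. -/
theorem abs_log_monomerProb_sub_limit_le {lam : ℝ} (hd : 0 < d) (hlam : 0 < lam)
    {S : Finset (Fin d → ℤ)} {v : Fin d → ℤ} (hv : v ∈ S) {R : Set (Fin d → ℤ)} {n : ℕ}
    (h : AgreeWithin (lexBelow S v : Set (Fin d → ℤ)) R (-v) n v) :
    |-Real.log (monomerProb lam (lexBelow S v) [] v) + logCavityLimit lam R| ≤
      2 * cavityError d lam n := by
  have hmem : v ∈ lexBelow S v := by simp [lexBelow, hv]
  have hB := isCavityBoundary_monomerProb hlam (lexBelow S v)
  have h1 := abs_log_cavityValue_sub_le (R := (lexBelow S v : Set (Fin d → ℤ))) hd hlam hB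
    (isCavityBoundary_one hlam) n [] v
  have e1 : cavityValue lam (lexBelow S v : Set (Fin d → ℤ)) (monomerProb lam (lexBelow S v)) n [] v =
      monomerProb lam (lexBelow S v) [] v :=
    cavityValue_monomerProb hlam _ n hmem
  have e2 := cavityValue_eq_of_agreeWithin (lam := lam) (c := 1) h []
  rw [List.map_nil, add_neg_cancel] at e2
  rw [e1, e2] at h1
  have h2 := abs_log_cavityValue_sub_limit_le hd hlam R n
  generalize Real.log (monomerProb lam (lexBelow S v) [] v) = x at *
  generalize Real.log (cavityValue lam R (fun _ _ => 1) n [] 0) = y at *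
  -- One error replaces the true boundary values by `1`, the other passes from depth `n` to the
  -- limit.
  rw [show -x + logCavityLimit lam R = -((x - y) + (y - logCavityLimit lam R)) by ring, abs_neg]
  exact (abs_add_le _ _).trans (by linarith)

theorem abs_log_monomerProb_le {lam : ℝ} (hlam : 0 < lam) (S : Finset (Fin d → ℤ))
    (X : List (Fin d → ℤ)) (v : Fin d → ℤ) :
    |Real.log (monomerProb lam S X v)| ≤ Real.log (1 + 2 * lam * d) := by
  have h := log_cavityValue_mem (R := ∅) hlam (isCavityBoundary_monomerProb hlam S) 0 X v
  rwa [cavityValue] at h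

/-! ### The free energy -/

open Classical in
/-- The vertices from which a vertex outside of `S` can be reached in `t` unit steps, with the last
step leaving `S`. -/
noncomputable def nearBoundary (S : Finset (Fin d → ℤ)) : ℕ → Finset (Fin d → ℤ)
  | 0 => ∅
  | t + 1 => innerBoundary d S ∪
      (unitSteps d).toFinset.biUnion fun e => (nearBoundary S t).image fun u => u - e

theorem exists_card_nearBoundary_le (d t : ℕ) :
    ∃ C : ℕ, ∀ S : Finset (Fin d → ℤ), (nearBoundary S t).card ≤ C * (innerBoundary d S).card := by
  classical
  induction t with
  | zero => exact ⟨0, fun S => by simp [nearBoundary]⟩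
  | succ t ih =>
    obtain ⟨C, hC⟩ := ih
    refine ⟨1 + 2 * d * C, fun S => ?_⟩
    rw [nearBoundary]
    have h1 : ((unitSteps d).toFinset.biUnion fun e =>
        (nearBoundary S t).image fun u => u - e).card ≤
        (unitSteps d).toFinset.card * (C * (innerBoundary d S).card) :=
      Finset.card_biUnion_le_card_mul _ _ _ fun e _ => Finset.card_image_le.trans (hC S)
    have h2 : (unitSteps d).toFinset.card ≤ 2 * d := by
      rw [← length_unitSteps d]; exact List.toFinset_card_le _
    calc _ ≤ (innerBoundary d S).card + 2 * d * (C * (innerBoundary d S).card) :=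
          (Finset.card_union_le _ _).trans
            (Nat.add_le_add_left (h1.trans (Nat.mul_le_mul_right _ h2)) _)
      _ = _ := by ring

/-- Walks of `t` steps from `u` stay in `S`, so only the order relative to `v` decides membership.
The base point `v` stays fixed while `u` moves in the induction. -/
theorem agreeWithin_of_notMem_nearBoundary {S : Finset (Fin d → ℤ)} (v : Fin d → ℤ) {t : ℕ}
    {u : Fin d → ℤ} (hu : u ∈ S) (h : u ∉ nearBoundary S t) :
    AgreeWithin (lexBelow S v : Set (Fin d → ℤ)) (cavityHalf d) (-v) t u := by
  classical
  induction t generalizing u with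
  | zero => trivial
  | succ t ih =>
    intro e he
    simp only [nearBoundary, Finset.mem_union, Finset.mem_biUnion, Finset.mem_image,
      List.mem_toFinset, not_or, not_exists, not_and] at h
    have hmem : u + e ∈ S := by
      by_contra hS
      refine h.1 (Finset.mem_filter.2 ⟨hu, u + e, latticeGraph_adj_add_iff.2 he, hS⟩)
    refine ⟨?_, ih hmem fun h' => h.2 e he _ h' (by abel)⟩
    rw [Finset.mem_coe, mem_lexBelow, ← sub_eq_add_neg]
    exact and_iff_right hmem

theorem abs_log_partitionFunction_sub_le {lam : ℝ} (hd : 0 < d) (hlam : 0 < lam) (t : ℕ)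
    (S : Finset (Fin d → ℤ)) :
    |Real.log (partitionFunction d lam S) + S.card * logCavityLimit lam (cavityHalf d)| ≤
      S.card * (2 * cavityError d lam t) + (nearBoundary S t).card *
        (Real.log (1 + 2 * lam * d) + |logCavityLimit lam (cavityHalf d)|) := by
  classical
  set L := logCavityLimit lam (cavityHalf d)
  set K := Real.log (1 + 2 * lam * d) + |L|
  have hK : 0 ≤ K := by
    have := abs_log_monomerProb_le hlam (∅ : Finset (Fin d → ℤ)) [] 0
    have := (abs_nonneg _).trans this
    positivity
  rw [log_partitionFunction_eq_sum hlam S, ← nsmul_eq_mul, ← Finset.sum_const,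
    ← Finset.sum_add_distrib]
  calc _ ≤ ∑ v ∈ S, |-Real.log (monomerProb lam (lexBelow S v) [] v) + L| :=
        Finset.abs_sum_le_sum_abs _ _
    _ ≤ ∑ v ∈ S, (2 * cavityError d lam t + if v ∈ nearBoundary S t then K else 0) := by
        refine Finset.sum_le_sum fun v hv => ?_
        split_ifs with h
        · have h1 := abs_log_monomerProb_le hlam (lexBelow S v) [] v
          have h2 := cavityError_nonneg (d := d) (lam := lam) t
          refine (abs_add_le _ _).trans ?_
          rw [abs_neg]
          linarith
        · rw [add_zero]
          exact abs_log_monomerProb_sub_limit_le hd hlam hv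
            (agreeWithin_of_notMem_nearBoundary v hv h)
    _ ≤ _ := by
        rw [Finset.sum_add_distrib, Finset.sum_const, nsmul_eq_mul, ← Finset.sum_filter,
          Finset.sum_const, nsmul_eq_mul]
        gcongr
        intro v hv
        exact (Finset.mem_filter.1 hv).2

theorem isFreeEnergy_neg_logCavityLimit {lam : ℝ} (hd : 0 < d) (hlam : 0 < lam) :
    IsFreeEnergy d lam (-logCavityLimit lam (cavityHalf d)) := by
  intro S hS
  set L := logCavityLimit lam (cavityHalf d)
  set K := Real.log (1 + 2 * lam * d) + |L|
  rw [Metric.tendsto_atTop']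
  intro ε hε
  -- The depth must be fixed before `n`: the constant `C` comparing `nearBoundary` with the boundary
  -- depends on it.
  obtain ⟨t, ht⟩ := ((tendsto_cavityError hd hlam).eventually_lt_const
    (show (0 : ℝ) < ε / 4 by positivity)).exists
  obtain ⟨C, hC⟩ := exists_card_nearBoundary_le d t
  have hlim : Filter.Tendsto (fun n => ((innerBoundary d (S n)).card : ℝ) / ((S n).card : ℝ) *
      (C * |K|)) Filter.atTop (𝓝 0) := by
    simpa using hS.2.mul_const (C * |K|)
  obtain ⟨n₀, hn₀⟩ := Filter.eventually_atTop.1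
    (hlim.eventually_lt_const (show (0 : ℝ) < ε / 2 by positivity))
  refine ⟨n₀, fun n hn => ?_⟩
  have hcard : (0 : ℝ) < (S n).card := by exact_mod_cast (hS.1 n).card_pos
  have h1 := abs_log_partitionFunction_sub_le hd hlam t (S n)
  have h2 := hn₀ n hn.le
  have h3 : ((nearBoundary (S n) t).card : ℝ) ≤ C * (innerBoundary d (S n)).card := by
    exact_mod_cast hC (S n)
  rw [Real.dist_eq, sub_neg_eq_add]
  have e : Real.log (partitionFunction d lam (S n)) / (S n).card + L =
      (Real.log (partitionFunction d lam (S n)) + (S n).card * L) / (S n).card := by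
    field_simp
  rw [e, abs_div, abs_of_pos hcard, div_lt_iff₀ hcard]
  rw [div_mul_eq_mul_div, div_lt_iff₀ hcard] at h2
  have h4 : ((nearBoundary (S n) t).card : ℝ) * K ≤ C * (innerBoundary d (S n)).card * |K| :=
    mul_le_mul h3 (le_abs_self K) (by
      have := abs_log_monomerProb_le hlam (∅ : Finset (Fin d → ℤ)) [] 0
      have := (abs_nonneg _).trans this
      positivity) (by positivity)
  have h5 : ((S n).card : ℝ) * (2 * cavityError d lam t) ≤ (S n).card * (ε / 2) := by
    gcongr; linarith
  linarith

/-! ### Faces of boxes -/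

/-- The part of `cavityHalf d` cut off by a face at distance `k` from the origin; the faces are
indexed by their direction and their side. -/
def faceRegion (f : Fin d × Bool) (k : ℕ) : Set (Fin d → ℤ) :=
  if f.2 then cavityUpper d f.1 k else cavityLower d f.1 k

/-- The distance of `v` from a face of the box with half-widths `N`. -/
def faceDist (N : Fin d → ℕ) (f : Fin d × Bool) (v : Fin d → ℤ) : ℕ :=
  if f.2 then ((N f.1 : ℤ) - v f.1).toNat else ((N f.1 : ℤ) + v f.1).toNat

/-- The contribution to the surface pressure of a vertex at distance `k` from a face. -/
noncomputable def faceExcess (lam : ℝ) (f : Fin d × Bool) (k : ℕ) : ℝ :=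
  logCavityLimit lam (cavityHalf d) - logCavityLimit lam (faceRegion f k)

/-- The box with half-widths `N`. -/
noncomputable def natBox (N : Fin d → ℕ) : Finset (Fin d → ℤ) :=
  Fintype.piFinset fun i => Finset.Icc (-(N i : ℤ)) (N i)

theorem mem_natBox {N : Fin d → ℕ} {v : Fin d → ℤ} :
    v ∈ natBox N ↔ ∀ i, -(N i : ℤ) ≤ v i ∧ v i ≤ N i := by
  simp [natBox]

theorem rectBox_eq_natBox {a : Fin d → ℝ} (ha : ∀ i, 0 < a i) (n : ℕ) :
    rectBox a n = natBox fun i => ⌊a i * n⌋₊ := by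
  have h : ∀ i, ⌊a i * n⌋ = (⌊a i * n⌋₊ : ℤ) := fun i =>
    (Int.natCast_floor_eq_floor (mul_nonneg (ha i).le (Nat.cast_nonneg n))).symm
  simp only [rectBox, natBox, h]

section

variable {lam : ℝ}

theorem agreeWithin_faceRegion (f : Fin d × Bool) (k : ℕ) :
    AgreeWithin (faceRegion f k) (cavityHalf d) 0 k 0 := by
  refine agreeWithin_of_cube fun u hu => ?_
  have h := hu f.1
  rw [Pi.zero_apply, sub_zero, abs_le] at h
  unfold faceRegion
  split_ifs
  · simp only [cavityUpper, Set.mem_ofPred_eq, add_zero, and_iff_left_iff_imp]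
    exact fun _ => h.2
  · simp only [cavityLower, Set.mem_ofPred_eq, add_zero, and_iff_left_iff_imp]
    exact fun _ => h.1

/-- A recursion of depth `k` cannot see a face at distance `k`, so both limits are close to the same
depth-`k` value. -/
theorem abs_faceExcess_le (hd : 0 < d) (hlam : 0 < lam) (f : Fin d × Bool) (k : ℕ) :
    |faceExcess lam f k| ≤ 2 * cavityError d lam k := by
  have h1 := abs_log_cavityValue_sub_limit_le hd hlam (cavityHalf d) k
  have h2 := abs_log_cavityValue_sub_limit_le hd hlam (faceRegion f k) k
  have e := cavityValue_eq_of_agreeWithin (lam := lam) (c := 1) (agreeWithin_faceRegion f k) []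
  rw [List.map_nil, add_zero] at e
  rw [e] at h2
  rw [faceExcess]
  rw [abs_le] at h1 h2 ⊢
  constructor <;> linarith [h1.1, h1.2, h2.1, h2.2]

theorem agreeWithin_natBox {N : Fin d → ℕ} {v : Fin d → ℤ} (hv : v ∈ natBox N) {f : Fin d × Bool}
    {n : ℕ} (h : ∀ g, g ≠ f → n ≤ faceDist N g v) :
    AgreeWithin (lexBelow (natBox N) v : Set (Fin d → ℤ)) (faceRegion f (faceDist N f v)) (-v) n
      v := by
  rw [mem_natBox] at hv
  refine agreeWithin_of_cube fun u hu => ?_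
  rw [Finset.mem_coe, mem_lexBelow, mem_natBox, ← sub_eq_add_neg]
  have hup : ∀ i, (i, true) ≠ f → u i ≤ N i := fun i hi => by
    have h1 := h _ hi
    have h2 := (abs_le.1 (hu i)).2
    have h3 := hv i
    simp only [faceDist, if_true] at h1
    omega
  have hlow : ∀ i, (i, false) ≠ f → -(N i : ℤ) ≤ u i := fun i hi => by
    have h1 := h _ hi
    have h2 := (abs_le.1 (hu i)).1
    have h3 := hv i
    simp only [faceDist, Bool.false_eq_true, if_false] at h1
    omega
  obtain ⟨j, b⟩ := f
  have h3 := hv j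
  cases b
  · simp only [faceRegion, faceDist, Bool.false_eq_true, if_false, cavityLower, Set.mem_ofPred_eq,
      Pi.sub_apply]
    constructor
    · rintro ⟨h1, h2⟩
      have := h1 j
      exact ⟨h2, by omega⟩
    · rintro ⟨h1, h2⟩
      refine ⟨fun i => ⟨?_, hup i (by simp)⟩, h1⟩
      by_cases hi : i = j
      · subst hi; omega
      · exact hlow i (by simp [hi])
  · simp only [faceRegion, faceDist, if_true, cavityUpper, Set.mem_ofPred_eq, Pi.sub_apply]
    constructor
    · rintro ⟨h1, h2⟩
      have := h1 j
      exact ⟨h2, by omega⟩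
    · rintro ⟨h1, h2⟩
      refine ⟨fun i => ⟨hlow i (by simp), ?_⟩, h1⟩
      by_cases hi : i = j
      · subst hi; omega
      · exact hup i (by simp [hi])

/-- Let `f` be a nearest face and `g` a nearest one among the others. Up to the distance of `g` only
`f` is visible, which produces the excess of `f`; all other excesses are counted as errors. As `f`
is nearest, each error `q^(2 dist g')` is at most `q^(dist f + dist g')`. Summing over all ordered
pairs removes the dependence of `f` on `v`. -/
theorem abs_natBox_vertex_sub_le (hd : 0 < d) (hlam : 0 < lam) {K q : ℝ} (hK : 0 < K) (hq : 0 < q)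
    (hq1 : q < 1) (hKq : ∀ n, cavityError d lam n ≤ K * q ^ (2 * n)) {N : Fin d → ℕ}
    {v : Fin d → ℤ} (hv : v ∈ natBox N) :
    |-Real.log (monomerProb lam (lexBelow (natBox N) v) [] v) + logCavityLimit lam (cavityHalf d) -
        ∑ f, faceExcess lam f (faceDist N f v)| ≤
      4 * K * ∑ f, ∑ g ∈ Finset.univ.erase f, q ^ (faceDist N f v + faceDist N g v) := by
  classical
  have : Nonempty (Fin d × Bool) := ⟨(⟨0, hd⟩, true)⟩
  obtain ⟨f, -, hf⟩ := Finset.exists_min_image Finset.univ (fun f => faceDist N f v)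
    Finset.univ_nonempty
  have hne : (Finset.univ.erase f).Nonempty :=
    ⟨(f.1, !f.2), by simp [Prod.ext_iff]⟩
  obtain ⟨g, hg, hgmin⟩ := Finset.exists_min_image (Finset.univ.erase f) (fun f => faceDist N f v) hne
  have hterm : ∀ g, cavityError d lam (faceDist N g v) ≤
      K * q ^ (faceDist N f v + faceDist N g v) := fun g => by
    refine (hKq _).trans ?_
    gcongr K * ?_
    refine pow_le_pow_of_le_one hq.le hq1.le ?_
    have := hf g (Finset.mem_univ g)
    omega
  have h1 := abs_log_monomerProb_sub_limit_le hd hlam hv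
    (agreeWithin_natBox hv fun g' hg' => hgmin g' (by simpa using hg'))
  have h2 := h1.trans (mul_le_mul_of_nonneg_left (hterm g) zero_le_two)
  have h3 : |∑ g ∈ Finset.univ.erase f, faceExcess lam g (faceDist N g v)| ≤
      ∑ g ∈ Finset.univ.erase f, 2 * (K * q ^ (faceDist N f v + faceDist N g v)) :=
    (Finset.abs_sum_le_sum_abs _ _).trans (Finset.sum_le_sum fun g _ =>
      (abs_faceExcess_le hd hlam g _).trans (mul_le_mul_of_nonneg_left (hterm g) zero_le_two))
  rw [← Finset.mul_sum, ← Finset.mul_sum] at h3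
  set T := ∑ g ∈ Finset.univ.erase f, q ^ (faceDist N f v + faceDist N g v) with hT
  have h4 : q ^ (faceDist N f v + faceDist N g v) ≤ T :=
    Finset.single_le_sum (f := fun g => q ^ (faceDist N f v + faceDist N g v))
      (fun _ _ => by positivity) hg
  have h5 : T ≤ ∑ f, ∑ g ∈ Finset.univ.erase f, q ^ (faceDist N f v + faceDist N g v) :=
    Finset.single_le_sum (f := fun f => ∑ g ∈ Finset.univ.erase f,
      q ^ (faceDist N f v + faceDist N g v))
      (fun _ _ => Finset.sum_nonneg fun _ _ => by positivity) (Finset.mem_univ f)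
  rw [← Finset.add_sum_erase _ _ (Finset.mem_univ f), faceExcess]
  set Z := ∑ g ∈ Finset.univ.erase f, faceExcess lam g (faceDist N g v)
  rw [show -Real.log (monomerProb lam (lexBelow (natBox N) v) [] v) +
      logCavityLimit lam (cavityHalf d) - (logCavityLimit lam (cavityHalf d) -
        logCavityLimit lam (faceRegion f (faceDist N f v)) + Z) =
      (-Real.log (monomerProb lam (lexBelow (natBox N) v) [] v) +
        logCavityLimit lam (faceRegion f (faceDist N f v))) - Z by ring]
  refine (abs_sub _ _).trans ?_
  have h6 : K * q ^ (faceDist N f v + faceDist N g v) ≤ K * T := by gcongr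
  have h7 := mul_le_mul_of_nonneg_left h5 hK.le
  linarith

end

/-! ### Sums over boxes -/

theorem sum_natBox_prod (N : Fin d → ℕ) (F : Fin d → ℤ → ℝ) :
    ∑ v ∈ natBox N, ∏ i, F i (v i) = ∏ i, ∑ x ∈ Finset.Icc (-(N i : ℤ)) (N i), F i x :=
  (Finset.prod_univ_sum _ _).symm

theorem card_Icc_neg (n : ℕ) : ((Finset.Icc (-(n : ℤ)) n).card : ℝ) = 2 * n + 1 := by
  rw [Int.card_Icc, show ((n : ℤ) + 1 - -(n : ℤ)).toNat = 2 * n + 1 by omega]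
  push_cast; ring

theorem sum_Icc_faceDist (N : Fin d → ℕ) (f : Fin d × Bool) (F : ℕ → ℝ) :
    ∑ x ∈ Finset.Icc (-(N f.1 : ℤ)) (N f.1), F (faceDist N f fun _ => x) =
      ∑ k ∈ Finset.range (2 * N f.1 + 1), F k := by
  obtain ⟨j, b⟩ := f
  simp only [faceDist]
  cases b
  · refine Finset.sum_nbij' (fun x => ((N j : ℤ) + x).toNat) (fun k => (k : ℤ) - N j) ?_ ?_ ?_ ?_ ?_
    all_goals simp only [Finset.mem_Icc, Finset.mem_range, Bool.false_eq_true, if_false]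
    all_goals intros
    all_goals first | trivial | omega
  · refine Finset.sum_nbij' (fun x => ((N j : ℤ) - x).toNat) (fun k => (N j : ℤ) - k) ?_ ?_ ?_ ?_ ?_
    all_goals simp only [Finset.mem_Icc, Finset.mem_range, if_true]
    all_goals intros
    all_goals first | trivial | omega

theorem sum_natBox_face (N : Fin d → ℕ) (f : Fin d × Bool) (F : ℕ → ℝ) :
    ∑ v ∈ natBox N, F (faceDist N f v) =
      (∏ i ∈ Finset.univ.erase f.1, (2 * (N i : ℝ) + 1)) *
        ∑ k ∈ Finset.range (2 * N f.1 + 1), F k := by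
  have h := sum_natBox_prod N fun i x => if i = f.1 then F (faceDist N f fun _ => x) else 1
  simp only [Finset.prod_ite_eq', Finset.mem_univ, if_true] at h
  rw [← Finset.prod_erase_mul _ _ (Finset.mem_univ f.1)] at h
  simp only [if_true] at h
  rw [sum_Icc_faceDist] at h
  refine Eq.trans (Finset.sum_congr rfl fun v _ => rfl) (h.trans ?_)
  congr 1
  refine Finset.prod_congr rfl fun i hi => ?_
  simp [Finset.ne_of_mem_erase hi, ← card_Icc_neg]

/-- The factor `2 N + 1` on the left restores the width in the direction of `g`, so that the right
side carries the full area of the face `f`. -/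
theorem sum_natBox_two_faces (N : Fin d → ℕ) {f g : Fin d × Bool} (hfg : f.1 ≠ g.1) (F G : ℕ → ℝ) :
    (2 * (N g.1 : ℝ) + 1) * ∑ v ∈ natBox N, F (faceDist N f v) * G (faceDist N g v) =
      (∏ i ∈ Finset.univ.erase f.1, (2 * (N i : ℝ) + 1)) *
        ((∑ k ∈ Finset.range (2 * N f.1 + 1), F k) * ∑ k ∈ Finset.range (2 * N g.1 + 1), G k) := by
  have h := sum_natBox_prod N fun i x => (if i = f.1 then F (faceDist N f fun _ => x) else 1) *
    if i = g.1 then G (faceDist N g fun _ => x) else 1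
  simp only [Finset.prod_mul_distrib, Finset.prod_ite_eq', Finset.mem_univ, if_true] at h
  have hg : g.1 ∈ Finset.univ.erase f.1 := by simp [hfg.symm]
  rw [← Finset.prod_erase_mul _ _ (Finset.mem_univ f.1), ← Finset.prod_erase_mul _ _ hg] at h
  simp only [if_true, hfg, hfg.symm, if_false, mul_one, one_mul] at h
  rw [sum_Icc_faceDist, sum_Icc_faceDist] at h
  have hprod : ∏ x ∈ (Finset.univ.erase f.1).erase g.1, ∑ x_1 ∈ Finset.Icc (-(N x : ℤ)) (N x),
      ((if x = f.1 then F (faceDist N f fun _ => x_1) else 1) *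
        if x = g.1 then G (faceDist N g fun _ => x_1) else 1) =
      ∏ i ∈ (Finset.univ.erase f.1).erase g.1, (2 * (N i : ℝ) + 1) := by
    refine Finset.prod_congr rfl fun i hi => ?_
    simp [Finset.ne_of_mem_erase hi, Finset.ne_of_mem_erase (Finset.mem_of_mem_erase hi),
      ← card_Icc_neg]
  rw [hprod] at h
  rw [← Finset.prod_erase_mul _ _ hg]
  have h' : ∑ v ∈ natBox N, F (faceDist N f v) * G (faceDist N g v) = _ :=
    Eq.trans (Finset.sum_congr rfl fun v _ => rfl) h
  rw [h']
  ring

theorem card_natBox (N : Fin d → ℕ) (j : Fin d) :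
    ((natBox N).card : ℝ) =
      (∏ i ∈ Finset.univ.erase j, (2 * (N i : ℝ) + 1)) * (2 * (N j : ℝ) + 1) := by
  have := sum_natBox_face N (j, true) fun _ => 1
  simpa using this

theorem faceDist_add_faceDist {N : Fin d → ℕ} {f g : Fin d × Bool} (hfg : g ≠ f) (h1 : f.1 = g.1)
    {v : Fin d → ℤ} (hv : v ∈ natBox N) : faceDist N f v + faceDist N g v = 2 * N f.1 := by
  obtain ⟨j, b⟩ := f
  obtain ⟨j', b'⟩ := g
  have h1 : j = j' := h1
  subst h1
  have := mem_natBox.1 hv j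
  cases b <;> cases b' <;> simp [faceDist] at * <;> omega

theorem sum_geometric_le {q : ℝ} (hq : 0 < q) (hq1 : q < 1) (n : ℕ) :
    ∑ k ∈ Finset.range n, q ^ k ≤ 1 / (1 - q) := by
  have := (summable_geometric_of_lt_one hq.le hq1).sum_le_tsum (Finset.range n)
    fun _ _ => by positivity
  rwa [tsum_geometric_of_lt_one hq.le hq1, ← one_div] at this

/-- The distances to opposite faces add up to `2 N`, so such pairs are exponentially small. Faces in
different directions give a product of two geometric sums and lose one width. Both are negligible
against the area of a face. -/
theorem sum_natBox_pow_le {q : ℝ} (hq : 0 < q) (hq1 : q < 1) (N : Fin d → ℕ) {f g : Fin d × Bool}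
    (hfg : g ≠ f) :
    ∑ v ∈ natBox N, q ^ (faceDist N f v + faceDist N g v) ≤
      (∏ i ∈ Finset.univ.erase f.1, (2 * (N i : ℝ) + 1)) *
        ((1 / (1 - q)) ^ 2 / (2 * (N g.1 : ℝ) + 1) + (2 * (N f.1 : ℝ) + 1) * q ^ (2 * N f.1)) := by
  have h1q : 0 < 1 - q := by linarith
  have h_nonneg : 0 ≤ ∏ i ∈ Finset.univ.erase f.1, (2 * (N i : ℝ) + 1) :=
    Finset.prod_nonneg fun _ _ => by positivity
  by_cases h1 : f.1 = g.1
  · rw [Finset.sum_congr rfl fun v hv => by rw [faceDist_add_faceDist hfg h1 hv],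
      Finset.sum_const, nsmul_eq_mul, card_natBox N f.1, mul_assoc]
    gcongr
    have : 0 ≤ (1 / (1 - q)) ^ 2 / (2 * (N g.1 : ℝ) + 1) := by positivity
    linarith
  · have h := sum_natBox_two_faces N h1 (fun k => q ^ k) fun k => q ^ k
    simp only [← pow_add] at h
    have hN : (0 : ℝ) < 2 * (N g.1 : ℝ) + 1 := by positivity
    have h2 : (∑ k ∈ Finset.range (2 * N f.1 + 1), q ^ k) *
        ∑ k ∈ Finset.range (2 * N g.1 + 1), q ^ k ≤ (1 / (1 - q)) ^ 2 := by
      rw [sq]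
      exact mul_le_mul (sum_geometric_le hq hq1 _) (sum_geometric_le hq hq1 _)
        (Finset.sum_nonneg fun _ _ => by positivity) (by positivity)
    have h3 := mul_le_mul_of_nonneg_left h2 h_nonneg
    rw [← h] at h3
    calc _ ≤ (∏ i ∈ Finset.univ.erase f.1, (2 * (N i : ℝ) + 1)) *
          ((1 / (1 - q)) ^ 2 / (2 * (N g.1 : ℝ) + 1)) := by
          rw [← mul_div_assoc, le_div_iff₀ hN, mul_comm]; exact h3
      _ ≤ _ := by
          gcongr
          have : 0 ≤ (2 * (N f.1 : ℝ) + 1) * q ^ (2 * N f.1) := by positivity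
          linarith

/-! ### The surface pressure -/

theorem abs_log_partitionFunction_natBox_sub_le {lam : ℝ} (hd : 0 < d) (hlam : 0 < lam) {K q : ℝ}
    (hK : 0 < K) (hq : 0 < q) (hq1 : q < 1) (hKq : ∀ n, cavityError d lam n ≤ K * q ^ (2 * n))
    (N : Fin d → ℕ) :
    |Real.log (partitionFunction d lam (natBox N)) +
        (natBox N).card * logCavityLimit lam (cavityHalf d) -
        ∑ f : Fin d × Bool, (∏ i ∈ Finset.univ.erase f.1, (2 * (N i : ℝ) + 1)) *
          ∑ k ∈ Finset.range (2 * N f.1 + 1), faceExcess lam f k| ≤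
      4 * K * ∑ f : Fin d × Bool, ∑ g ∈ Finset.univ.erase f,
        (∏ i ∈ Finset.univ.erase f.1, (2 * (N i : ℝ) + 1)) *
        ((1 / (1 - q)) ^ 2 / (2 * (N g.1 : ℝ) + 1) +
          (2 * (N f.1 : ℝ) + 1) * q ^ (2 * N f.1)) := by
  rw [log_partitionFunction_eq_sum hlam, ← nsmul_eq_mul, ← Finset.sum_const,
    ← Finset.sum_add_distrib]
  simp only [← sum_natBox_face]
  rw [Finset.sum_comm, ← Finset.sum_sub_distrib]
  refine (Finset.abs_sum_le_sum_abs _ _).trans ((Finset.sum_le_sum fun v hv =>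
    abs_natBox_vertex_sub_le hd hlam hK hq hq1 hKq hv).trans ?_)
  rw [← Finset.mul_sum, Finset.sum_comm]
  gcongr with f
  rw [Finset.sum_comm]
  gcongr with g hg
  exact sum_natBox_pow_le hq hq1 N (Finset.ne_of_mem_erase hg)

theorem summable_faceExcess {lam : ℝ} (hd : 0 < d) (hlam : 0 < lam) (f : Fin d × Bool) :
    Summable (faceExcess lam f) := by
  obtain ⟨K, q, hK, hq, hq1, hKq⟩ := exists_cavityError_le hd hlam
  have hgeo : Summable fun n : ℕ => 2 * (K * (q ^ 2) ^ n) :=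
    ((summable_geometric_of_lt_one (by positivity) (by nlinarith)).mul_left K).mul_left 2
  refine hgeo.of_norm_bounded fun n => ?_
  rw [Real.norm_eq_abs, ← pow_mul]
  exact (abs_faceExcess_le hd hlam f n).trans (mul_le_mul_of_nonneg_left (hKq n) zero_le_two)

/-- The value of the surface pressure. -/
noncomputable def surfacePressureValue (lam : ℝ) (a : Fin d → ℝ) : ℝ :=
  (∑ f : Fin d × Bool, (∏ k ∈ Finset.univ.erase f.1, (2 * a k)) * ∑' k, faceExcess lam f k) /
    surfaceArea a

/-- After division by `n^(d-1)`, face areas converge, sums over the distance to a face become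
partial sums of convergent series, and the two-face errors vanish. -/
theorem isSurfacePressure_surfacePressureValue {lam : ℝ} (hd : 0 < d) (hlam : 0 < lam)
    {a : Fin d → ℝ} (ha : ∀ i, 0 < a i) :
    IsSurfacePressure d lam (-logCavityLimit lam (cavityHalf d)) a (surfacePressureValue lam a) := by
  obtain ⟨K, q, hK, hq, hq1, hKq⟩ := exists_cavityError_le hd hlam
  set N : ℕ → Fin d → ℕ := fun n i => ⌊a i * n⌋₊ with hN
  have hNtop : ∀ i, Filter.Tendsto (fun n => N n i) Filter.atTop Filter.atTop := fun i =>
    tendsto_nat_floor_atTop.comp (tendsto_natCast_atTop_atTop.const_mul_atTop (ha i))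
  have hwidth : ∀ i, Filter.Tendsto (fun n : ℕ => (2 * (N n i : ℝ) + 1) / n) Filter.atTop
      (𝓝 (2 * a i)) := fun i => by
    have h1 := (tendsto_nat_floor_mul_div_atTop (ha i).le).comp
      (tendsto_natCast_atTop_atTop (R := ℝ))
    have h2 := (h1.const_mul 2).add tendsto_one_div_atTop_nhds_zero_nat
    rw [add_zero] at h2
    refine h2.congr fun n => ?_
    simp only [Function.comp_apply, hN]
    ring
  have harea : ∀ j, Filter.Tendsto
      (fun n : ℕ => (∏ i ∈ Finset.univ.erase j, (2 * (N n i : ℝ) + 1)) / (n : ℝ) ^ (d - 1))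
      Filter.atTop (𝓝 (∏ i ∈ Finset.univ.erase j, (2 * a i))) := fun j => by
    refine (tendsto_finsetProd (Finset.univ.erase j) fun i _ => hwidth i).congr fun n => ?_
    rw [Finset.prod_div_distrib, Finset.prod_const, Finset.card_erase_of_mem (Finset.mem_univ j),
      Finset.card_univ, Fintype.card_fin]
  have hmain : Filter.Tendsto (fun n : ℕ => (∑ f : Fin d × Bool,
      (∏ i ∈ Finset.univ.erase f.1, (2 * (N n i : ℝ) + 1)) *
        ∑ k ∈ Finset.range (2 * N n f.1 + 1), faceExcess lam f k) / (n : ℝ) ^ (d - 1)) Filter.atTop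
      (𝓝 (∑ f : Fin d × Bool, (∏ k ∈ Finset.univ.erase f.1, (2 * a k)) *
        ∑' k, faceExcess lam f k)) := by
    simp only [Finset.sum_div]
    refine tendsto_finsetSum _ fun f _ => ?_
    have h1 : Filter.Tendsto (fun n => 2 * N n f.1 + 1) Filter.atTop Filter.atTop :=
      Filter.tendsto_atTop_mono (fun n => by omega) (hNtop f.1)
    have h2 := (summable_faceExcess hd hlam f).hasSum.tendsto_sum_nat.comp h1
    refine ((harea f.1).mul h2).congr fun n => ?_
    simp only [Function.comp_apply]
    ring
  have herr : Filter.Tendsto (fun n : ℕ => (4 * K * ∑ f : Fin d × Bool, ∑ g ∈ Finset.univ.erase f,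
        (∏ i ∈ Finset.univ.erase f.1, (2 * (N n i : ℝ) + 1)) *
        ((1 / (1 - q)) ^ 2 / (2 * (N n g.1 : ℝ) + 1) +
          (2 * (N n f.1 : ℝ) + 1) * q ^ (2 * N n f.1))) / (n : ℝ) ^ (d - 1)) Filter.atTop (𝓝 0) := by
    -- Zero in the shape of the termwise limit; `q⁻¹` comes from writing `(2N+1) q^(2N)` as `q⁻¹
    -- (2N+1) q^(2N+1)`.
    have hzero : (0 : ℝ) = 4 * K * ∑ f : Fin d × Bool, ∑ g ∈ Finset.univ.erase f,
        (∏ i ∈ Finset.univ.erase f.1, (2 * a i)) * (0 + q⁻¹ * 0) := by simp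
    rw [hzero]
    simp only [mul_div_assoc, Finset.sum_div]
    refine Filter.Tendsto.const_mul _ (tendsto_finsetSum _ fun f _ => tendsto_finsetSum _
      fun g _ => ?_)
    have hcast : ∀ i, Filter.Tendsto (fun n => 2 * (N n i : ℝ) + 1) Filter.atTop Filter.atTop :=
      fun i => Filter.tendsto_atTop_mono (fun n => by
        have : (0 : ℝ) ≤ N n i := Nat.cast_nonneg _
        show (N n i : ℝ) ≤ _
        linarith) (tendsto_natCast_atTop_atTop.comp (hNtop i))
    have h1 : Filter.Tendsto (fun n => (1 / (1 - q)) ^ 2 / (2 * (N n g.1 : ℝ) + 1)) Filter.atTop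
        (𝓝 0) := (hcast g.1).const_div_atTop _
    have h2 : Filter.Tendsto (fun n => ((2 * N n f.1 + 1 : ℕ) : ℝ) * q ^ (2 * N n f.1 + 1))
        Filter.atTop (𝓝 0) :=
      (tendsto_self_mul_const_pow_of_lt_one hq.le hq1).comp
        (Filter.tendsto_atTop_mono (fun n => by omega) (hNtop f.1))
    refine ((harea f.1).mul (h1.add (h2.const_mul q⁻¹))).congr fun n => ?_
    rw [pow_succ]
    push_cast
    field_simp
    ring
  have hdiff : Filter.Tendsto (fun n : ℕ =>
      (Real.log (partitionFunction d lam (natBox (N n))) +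
        (natBox (N n)).card * logCavityLimit lam (cavityHalf d)) / (n : ℝ) ^ (d - 1) -
      (∑ f : Fin d × Bool, (∏ i ∈ Finset.univ.erase f.1, (2 * (N n i : ℝ) + 1)) *
        ∑ k ∈ Finset.range (2 * N n f.1 + 1), faceExcess lam f k) / (n : ℝ) ^ (d - 1))
      Filter.atTop (𝓝 0) := by
    refine squeeze_zero_norm (fun n => ?_) herr
    rw [← sub_div, Real.norm_eq_abs, abs_div, abs_of_nonneg (by positivity : 0 ≤ (n : ℝ) ^ (d - 1))]
    exact div_le_div_of_nonneg_right
      (abs_log_partitionFunction_natBox_sub_le hd hlam hK hq hq1 hKq (N n)) (by positivity)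
  have hsum := (hdiff.add hmain).div_const (surfaceArea a)
  rw [zero_add] at hsum
  refine hsum.congr fun n => ?_
  rw [rectBox_eq_natBox ha, sub_add_cancel, div_div, mul_comm ((n : ℝ) ^ (d - 1)), mul_neg,
    sub_neg_eq_add]

/-- The weight `A_j(a) / A(a)` of a direction. -/
theorem area_div_surfaceArea {a : Fin d → ℝ} (ha : ∀ i, 0 < a i) (j : Fin d) :
    (∏ k ∈ Finset.univ.erase j, (2 * a k)) / surfaceArea a = 1 / a j / ∑ i, 1 / a i := by
  have hA : ∀ j, ∏ k ∈ Finset.univ.erase j, (2 * a k) = (∏ k, (2 * a k)) / 2 * (1 / a j) := by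
    intro j
    rw [← Finset.prod_erase_mul _ _ (Finset.mem_univ j)]
    have := (ha j).ne'
    field_simp
  have hP : (∏ k, (2 * a k)) / 2 ≠ 0 :=
    (div_pos (Finset.prod_pos fun k _ => by have := ha k; positivity) two_pos).ne'
  rw [surfaceArea, hA j, Finset.sum_congr rfl fun j _ => hA j, ← Finset.mul_sum,
    mul_div_mul_left _ _ hP]

/-! ### Values and step counts of the algorithm -/

namespace Timed

variable {α β : Type}

@[simp] theorem val_pure (x : α) : (pure x : Timed α).val = x := rfl
@[simp] theorem steps_pure (x : α) : (pure x : Timed α).steps = 0 := rfl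
@[simp] theorem val_bind (m : Timed α) (f : α → Timed β) : (m >>= f).val = (f m.val).val := rfl
@[simp] theorem steps_bind (m : Timed α) (f : α → Timed β) :
    (m >>= f).steps = m.steps + (f m.val).steps := rfl
@[simp] theorem val_instr (c : ℕ) (x : α) : (instr c x).val = x := rfl
@[simp] theorem steps_instr (c : ℕ) (x : α) : (instr c x).steps = c := rfl

theorem val_foldlM (f : β → α → Timed β) (l : List α) (b : β) :
    (l.foldlM f b).val = l.foldl (fun b a => (f b a).val) b := by
  induction l generalizing b with
  | nil => rfl
  | cons a l ih => rw [List.foldlM_cons, val_bind, ih, List.foldl_cons]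

theorem val_foldlM_add {f : ℝ → α → Timed ℝ} {g : α → ℝ} (h : ∀ s a, (f s a).val = s + g a)
    (l : List α) (b : ℝ) : (l.foldlM f b).val = b + (l.map g).sum := by
  rw [val_foldlM]
  simp only [h]
  induction l generalizing b with
  | nil => simp
  | cons a l ih => rw [List.foldl_cons, ih, List.map_cons, List.sum_cons, add_assoc]

theorem steps_foldlM_le {f : β → α → Timed β} {c : ℕ} (h : ∀ b a, (f b a).steps ≤ c) (l : List α)
    (b : β) : (l.foldlM f b).steps ≤ l.length * c := by
  induction l generalizing b with
  | nil => simp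
  | cons a l ih =>
    rw [List.foldlM_cons, steps_bind, List.length_cons, add_mul, one_mul, add_comm]
    exact Nat.add_le_add (ih _) (h b a)

theorem inRegion_and_not_inList_iff {R : Set (Fin d → ℤ)} {Y : List (Fin d → ℤ)}
    {u : Fin d → ℤ} :
    ((inRegion R u).val && !(inList Y u).val) = true ↔ u ∈ R ∧ u ∉ Y := by
  simp [inRegion, inList]

theorem steps_inRegion (R : Set (Fin d → ℤ)) (u : Fin d → ℤ) :
    (inRegion R u).steps = 2 * d + 1 := rfl

theorem steps_inList (Y : List (Fin d → ℤ)) (u : Fin d → ℤ) :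
    (inList Y u).steps = Y.length * (d + 1) + 1 := rfl

end Timed

theorem val_cavity (lam : ℝ) (R : Set (Fin d → ℤ)) (b : ℝ) (t : ℕ) (X : List (Fin d → ℤ))
    (v : Fin d → ℤ) :
    (cavity lam R b t X v).val = cavityValue lam R (fun _ _ => b) t X v := by
  classical
  induction t generalizing X v with
  | zero => rfl
  | succ t ih =>
    rw [cavity, cavityValue]
    simp only [Timed.val_bind, Timed.val_instr, Timed.mul, Timed.add, Timed.div]
    rw [Timed.val_foldlM_add (g := fun e => if v + e ∈ R ∧ v + e ∉ v :: X then
      cavityValue lam R (fun _ _ => b) t (v :: X) (v + e) else 0)]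
    · rw [zero_add, openSteps, Finset.sum_filter, List.sum_toFinset _ (nodup_unitSteps d)]
    · intro s e
      simp only [Timed.tick, Timed.translate, Timed.val_bind, Timed.val_instr]
      by_cases h : v + e ∈ R ∧ v + e ∉ v :: X
      · rw [if_pos h, if_pos (Timed.inRegion_and_not_inList_iff.2 h), Timed.val_bind, ih,
          Timed.val_instr]
      · rw [if_neg h, if_neg (Timed.inRegion_and_not_inList_iff.not.2 h), Timed.val_pure, add_zero]

/-- The first factor bounds the work at one node: four operations, and for each of `2d` steps the
tests and one addition. The list grows by one per level, so `n` bounds its length throughout. With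
`T` the bound at depth `t`, own work and calls cost at most `T + 2d T`. -/
theorem steps_cavity_le (lam : ℝ) (R : Set (Fin d → ℤ)) (b : ℝ) (n t : ℕ) (X : List (Fin d → ℤ))
    (v : Fin d → ℤ) (h : X.length + t ≤ n) :
    (cavity lam R b t X v).steps ≤ (4 + 2 * d * (3 * d + 4 + n * (d + 1))) * (2 * d + 1) ^ t := by
  induction t generalizing X v with
  | zero =>
    show 1 ≤ _
    rw [pow_zero, mul_one]
    omega
  | succ t ih =>
    rw [cavity]
    simp only [Timed.steps_bind, Timed.val_instr, Timed.steps_instr, Timed.mul, Timed.add,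
      Timed.div]
    set T := (4 + 2 * d * (3 * d + 4 + n * (d + 1))) * (2 * d + 1) ^ t with hT
    have hfold := Timed.steps_foldlM_le (α := Fin d → ℤ) (f := fun (s : ℝ) e => do
      Timed.tick
      let u ← Timed.translate v e
      let inside ← Timed.inRegion R u
      let removed ← Timed.inList (v :: X) u
      if inside && !removed then
        let x ← cavity lam R b t (v :: X) u
        Timed.add s x
      else
        pure s) (c := 3 * d + 4 + n * (d + 1) + T) (fun s e => by
        have h1 : (cavity lam R b t (v :: X) (v + e)).steps ≤ T :=
          ih _ _ (by rw [List.length_cons]; omega)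
        have h2 : (v :: X).length * (d + 1) ≤ n * (d + 1) :=
          Nat.mul_le_mul_right _ (by rw [List.length_cons]; omega)
        simp only [Timed.tick, Timed.translate, Timed.steps_bind, Timed.val_instr,
          Timed.steps_instr, Timed.steps_inRegion, Timed.steps_inList]
        by_cases h : v + e ∈ R ∧ v + e ∉ v :: X
        · rw [if_pos (Timed.inRegion_and_not_inList_iff.2 h), Timed.steps_bind]
          simp only [Timed.add, Timed.steps_instr]
          omega
        · rw [if_neg (Timed.inRegion_and_not_inList_iff.not.2 h), Timed.steps_pure]
          omega) (unitSteps d) 0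
    rw [length_unitSteps] at hfold
    have hle : 4 + 2 * d * (3 * d + 4 + n * (d + 1)) ≤ T :=
      Nat.le_mul_of_pos_right _ (by positivity)
    have e : (4 + 2 * d * (3 * d + 4 + n * (d + 1))) * (2 * d + 1) ^ (t + 1) =
        T + 2 * d * T := by rw [hT]; ring
    rw [e]
    rw [mul_add] at hfold
    refine le_trans (Nat.add_le_add_left (Nat.add_le_add_right hfold _) 1) ?_
    omega

theorem steps_cavity_nil_le (hd : 2 ≤ d) (lam : ℝ) (R : Set (Fin d → ℤ)) (b : ℝ) (t : ℕ)
    (v : Fin d → ℤ) : (cavity lam R b t [] v).steps ≤ d ^ (8 + 4 * t) := by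
  have hpow : ∀ {i j : ℕ}, i ≤ j → d ^ i ≤ d ^ j := fun h => Nat.pow_le_pow_right (by omega) h
  have h2 : 2 ^ 2 ≤ d ^ 2 := Nat.pow_le_pow_left hd 2
  have h3 : 2 ^ 3 ≤ d ^ 3 := Nat.pow_le_pow_left hd 3
  have ht : t ≤ d ^ t := (Nat.lt_pow_self (by omega)).le
  have hd3 : 2 * d + 1 ≤ d ^ 3 := by nlinarith
  have ha : d + 1 ≤ d ^ 2 := by nlinarith
  have hb : 3 * d + 4 ≤ d ^ 4 := by nlinarith
  have hc : 2 * d ≤ d ^ 2 := by nlinarith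
  calc _ ≤ (4 + 2 * d * (3 * d + 4 + t * (d + 1))) * (2 * d + 1) ^ t :=
        steps_cavity_le lam R b t t [] v (by simp)
    _ ≤ (d ^ 2 + d ^ 2 * (d ^ 4 + d ^ t * d ^ 2)) * (d ^ 3) ^ t := by gcongr; omega
    _ = (d ^ 2 + d ^ 6 + d ^ (4 + t)) * d ^ (3 * t) := by ring
    _ ≤ (d ^ (6 + t) + d ^ (6 + t) + d ^ (6 + t)) * d ^ (3 * t) := by
        gcongr <;> omega
    _ ≤ (d ^ 2 * d ^ (6 + t)) * d ^ (3 * t) := by gcongr; nlinarith [Nat.zero_le (d ^ (6 + t))]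
    _ = d ^ (8 + 4 * t) := by ring

theorem val_logCavity (lam : ℝ) (R : Set (Fin d → ℤ)) (t : ℕ) :
    (logCavity lam R t).val = Real.log (cavityValue lam R (fun _ _ => 1) t [] 0) := by
  simp only [logCavity, Timed.val_bind, Timed.val_instr, Timed.log, val_cavity]

theorem steps_logCavity_le (hd : 2 ≤ d) (lam : ℝ) (R : Set (Fin d → ℤ)) (t : ℕ) :
    (logCavity lam R t).steps ≤ d ^ (9 + 4 * t) := by
  simp only [logCavity, Timed.steps_bind, Timed.val_instr, Timed.steps_instr, Timed.log]
  have h := steps_cavity_nil_le hd lam R 1 t 0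
  have h1 : d ^ 2 ≤ d ^ (8 + 4 * t) := Nat.pow_le_pow_right (by omega) (by omega)
  have h2 : d ^ (9 + 4 * t) = d * d ^ (8 + 4 * t) := by ring
  rw [h2]
  nlinarith

theorem val_scaScale (d : ℕ) (lam : ℝ) : (scaScale d lam).val = Real.sqrt (1 + 2 * lam * d) := rfl

theorem val_scaDepth (d : ℕ) (lam δ : ℝ) :
    (scaDepth d lam δ).val =
      2 * ⌈10 * (Real.sqrt (1 + 2 * lam * d) * (1 + Real.log (1 + 1 / δ)))⌉₊ := rfl

theorem steps_scaDepth (d : ℕ) (lam δ : ℝ) :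
    (scaDepth d lam δ).steps = 12 + (scaDepth d lam δ).val := by
  have : (scaDepth d lam δ).steps =
    4 + (1 + (1 + (1 + (1 + (1 + (1 + ((2 *
      ⌈10 * (Real.sqrt (1 + 2 * lam * d) * (1 + Real.log (1 + 1 / δ)))⌉₊ + 1) + 1))))))) := rfl
  rw [this, val_scaDepth]
  omega

theorem val_scaFreeEnergy (d : ℕ) (lam ε : ℝ) :
    (scaFreeEnergy d lam ε).val =
      -Real.log (cavityValue lam (cavityHalf d) (fun _ _ => 1) (scaDepth d lam ε).val [] 0) := by
  simp only [scaFreeEnergy, Timed.val_bind, Timed.val_instr, Timed.sub, val_logCavity, zero_sub]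

theorem steps_scaFreeEnergy_le (hd : 2 ≤ d) (lam ε : ℝ) :
    (scaFreeEnergy d lam ε).steps ≤ d ^ (13 + 5 * (scaDepth d lam ε).val) := by
  simp only [scaFreeEnergy, Timed.steps_bind, Timed.sub, Timed.steps_instr, steps_scaDepth]
  set t := (scaDepth d lam ε).val
  have h := steps_logCavity_le hd lam (cavityHalf d) t
  have ht : t ≤ d ^ t := (Nat.lt_pow_self (by omega)).le
  have h1 : d ^ t ≤ d ^ (9 + 4 * t) := Nat.pow_le_pow_right (by omega) (by omega)
  have h2 : 2 ^ 9 ≤ d ^ (9 + 4 * t) :=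
    (Nat.pow_le_pow_left hd 9).trans (Nat.pow_le_pow_right (by omega) (by omega))
  have h3 : 2 ^ 4 ≤ d ^ (4 + t) :=
    (Nat.pow_le_pow_left hd 4).trans (Nat.pow_le_pow_right (by omega) (by omega))
  have e : d ^ (13 + 5 * t) = d ^ (4 + t) * d ^ (9 + 4 * t) := by ring
  rw [e]
  nlinarith

theorem val_scaSurfacePressure (d : ℕ) (lam : ℝ) (a : Fin d → ℝ) (ε : ℝ) :
    (scaSurfacePressure d lam a ε).val =
      ∑ j, 1 / a j / (∑ i, 1 / a i) *
        ∑ k ∈ Finset.range (scaDepth d lam (ε / Real.sqrt (1 + 2 * lam * d))).val,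
          (2 * Real.log (cavityValue lam (cavityHalf d) (fun _ _ => 1)
              (scaDepth d lam (ε / Real.sqrt (1 + 2 * lam * d))).val [] 0) -
            Real.log (cavityValue lam (cavityUpper d j k) (fun _ _ => 1)
              (scaDepth d lam (ε / Real.sqrt (1 + 2 * lam * d))).val [] 0) -
            Real.log (cavityValue lam (cavityLower d j k) (fun _ _ => 1)
              (scaDepth d lam (ε / Real.sqrt (1 + 2 * lam * d))).val [] 0)) := by
  simp only [scaSurfacePressure, Timed.val_bind, Timed.div, Timed.val_instr, val_scaScale,
    val_logCavity, Timed.mul]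
  set t := (scaDepth d lam (ε / Real.sqrt (1 + 2 * lam * d))).val
  have hfin : ∀ g : Fin d → ℝ, ((List.finRange d).map g).sum = ∑ i, g i := fun g => by
    rw [Fin.sum_univ_def]
  have hrange : ∀ g : ℕ → ℝ, ((List.range t).map g).sum = ∑ k ∈ Finset.range t, g k := fun g =>
    rfl
  have htotal : ((List.finRange d).foldlM (fun w i => do
      Timed.tick
      let x ← Timed.instr 1 (1 / a i)
      Timed.add w x) (0 : ℝ)).val = ∑ i, 1 / a i := by
    rw [Timed.val_foldlM_add (g := fun i => 1 / a i) (fun w i => rfl), zero_add, hfin]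
  rw [htotal]
  refine (Timed.val_foldlM_add (fun r j => ?_) _ _).trans ((zero_add _).trans (hfin _))
  simp only [Timed.val_bind, Timed.val_instr, Timed.add]
  congr 2
  refine (Timed.val_foldlM_add (fun c k => ?_) _ _).trans ((zero_add _).trans (hrange _))
  simp only [Timed.val_bind, Timed.val_instr, Timed.sub, val_logCavity]

theorem steps_scaSurfacePressure_le (hd : 2 ≤ d) (lam : ℝ) (a : Fin d → ℝ) (ε : ℝ) :
    (scaSurfacePressure d lam a ε).steps ≤
      d ^ (13 + 5 * (scaDepth d lam (ε / Real.sqrt (1 + 2 * lam * d))).val) := by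
  have hscale : (scaScale d lam).steps = 4 := rfl
  simp only [scaSurfacePressure, Timed.steps_bind, Timed.div, Timed.val_instr, Timed.steps_instr,
    val_scaScale, hscale, steps_scaDepth, Timed.mul]
  set t := (scaDepth d lam (ε / Real.sqrt (1 + 2 * lam * d))).val
  set g := d ^ (9 + 4 * t) with hg
  have hlog : ∀ R, (logCavity lam R t).steps ≤ g := fun R => steps_logCavity_le hd lam R t
  have hl := hlog (cavityHalf d)
  have ht : t ≤ d ^ t := (Nat.lt_pow_self (by omega)).le
  have hp : 1 ≤ d ^ t := Nat.one_le_pow _ _ (by omega)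
  have h1 : d ^ t ≤ g := Nat.pow_le_pow_right (by omega) (by omega)
  have h2 : 2 ^ 9 ≤ g :=
    (Nat.pow_le_pow_left hd 9).trans (Nat.pow_le_pow_right (by omega) (by omega))
  have h3 : d ^ 3 ≤ g := Nat.pow_le_pow_right (by omega) (by omega)
  have h4 : 3 * d ≤ d ^ 3 := by nlinarith [Nat.pow_le_pow_left hd 2]
  have e : d ^ (13 + 5 * t) = d ^ 3 * (d * d ^ t * g) := by rw [hg]; ring
  have h8 : 2 ^ 3 ≤ d ^ 3 := Nat.pow_le_pow_left hd 3
  -- In order: the scale, the division giving `δ`, the depth, the bulk value, its doubling, the sum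
  -- of the `1 / a i`, and the double loop over directions and distances.
  have hbound : 4 + (1 + (12 + t + (g + (1 + (d * 3 + d * (5 + t * (4 + 2 * g))))))) ≤
      d ^ (13 + 5 * t) := by
    rw [e]
    calc _ ≤ 4 * g + d * (g + d ^ t * (g + 2 * g)) := by
          have : d * (5 + t * (4 + 2 * g)) ≤ d * (g + d ^ t * (g + 2 * g)) := by
            gcongr <;> omega
          omega
      _ ≤ 4 * (d * d ^ t * g) + 4 * (d * d ^ t * g) := by
          have h5 : g ≤ d ^ t * g := Nat.le_mul_of_pos_left _ hp
          have h6 : d ^ t * g ≤ d * (d ^ t * g) := Nat.le_mul_of_pos_left _ (by omega)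
          have h7 : d * g ≤ d * (d ^ t * g) := Nat.mul_le_mul_left _ h5
          nlinarith
      _ = 2 ^ 3 * (d * d ^ t * g) := by ring
      _ ≤ _ := by gcongr
  refine le_trans ?_ hbound
  gcongr
  · refine (Timed.steps_foldlM_le (c := 3) (fun w i => ?_) _ _).trans (by simp)
    exact le_of_eq rfl
  · refine (Timed.steps_foldlM_le (c := 5 + t * (4 + 2 * g)) (fun r j => ?_) _ _).trans (by simp)
    simp only [Timed.steps_bind, Timed.steps_instr, Timed.tick, Timed.add]
    have hin : ∀ (f : ℝ → ℕ → Timed ℝ), (∀ c k, (f c k).steps ≤ 4 + 2 * g) →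
        ((List.range t).foldlM f 0).steps ≤ t * (4 + 2 * g) := fun f hf =>
      (Timed.steps_foldlM_le hf _ _).trans (by simp)
    refine le_trans (Nat.add_le_add_left (Nat.add_le_add_right (hin _ fun c k => ?_) _) _) ?_
    · simp only [Timed.steps_bind, Timed.steps_instr, Timed.sub]
      have := hlog (cavityUpper d j k)
      have := hlog (cavityLower d j k)
      omega
    · omega

/-! ### Accuracy of the algorithm -/

theorem two_pow_ten_le_exp_ten : (1024 : ℝ) ≤ Real.exp 10 := by
  have h : (2 : ℝ) ≤ Real.exp 1 := by
    have := Real.add_one_le_exp (1 : ℝ)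
    linarith
  calc (1024 : ℝ) = 2 ^ 10 := by norm_num
    _ ≤ Real.exp 1 ^ 10 := by gcongr
    _ = Real.exp 10 := by rw [← Real.exp_nat_mul]; norm_num

/-- The logarithm in the depth supplies the factor `δ`; the constant `10` supplies `exp 10 ≥ 1024`,
which absorbs all later numerical constants. -/
theorem exp_neg_depth_le {m s δ : ℝ} (hδ : 0 < δ) (hs : 0 < s)
    (hm : 10 * (s * (1 + Real.log (1 + 1 / δ))) ≤ m) : Real.exp (-(m / s)) ≤ δ / 1024 := by
  have hL : 0 ≤ Real.log (1 + 1 / δ) := Real.log_nonneg (by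
    have : 0 < 1 / δ := by positivity
    linarith)
  have h1 : 10 + Real.log (1 + 1 / δ) ≤ m / s := by
    rw [le_div_iff₀ hs]
    nlinarith [mul_nonneg hs.le hL]
  have h2 : 1024 * (1 / δ) ≤ Real.exp (m / s) := by
    calc 1024 * (1 / δ) ≤ Real.exp 10 * (1 + 1 / δ) :=
          mul_le_mul two_pow_ten_le_exp_ten (by linarith) (by positivity) (Real.exp_pos _).le
      _ = Real.exp (10 + Real.log (1 + 1 / δ)) := by
          rw [Real.exp_add, Real.exp_log (by positivity)]
      _ ≤ _ := Real.exp_le_exp.2 h1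
  rw [Real.exp_neg, inv_le_comm₀ (Real.exp_pos _) (by positivity)]
  calc (δ / 1024)⁻¹ = 1024 * (1 / δ) := by field_simp
    _ ≤ _ := h2

theorem exists_scaDepth_eq {lam δ : ℝ} (hd : 0 < d) (hlam : 0 < lam) (hδ : 0 < δ) :
    ∃ m : ℕ, (scaDepth d lam δ).val = 2 * m ∧ Real.sqrt (1 + 2 * lam * d) ≤ m ∧
      Real.exp (-(m / Real.sqrt (1 + 2 * lam * d))) ≤ δ / 1024 := by
  have hs := one_lt_sqrt_scale hd hlam
  set s := Real.sqrt (1 + 2 * lam * d)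
  have hL : 0 ≤ Real.log (1 + 1 / δ) := Real.log_nonneg (by
    have : 0 < 1 / δ := by positivity
    linarith)
  have hceil := Nat.le_ceil (10 * (s * (1 + Real.log (1 + 1 / δ))))
  refine ⟨_, val_scaDepth d lam δ, ?_, exp_neg_depth_le hδ (by linarith) hceil⟩
  refine le_trans ?_ hceil
  nlinarith [mul_nonneg (by linarith : (0 : ℝ) ≤ s) hL]

theorem cavityError_le_of_two_mul_le {lam : ℝ} (hd : 0 < d) (hlam : 0 < lam) {m n : ℕ}
    (hm : Real.sqrt (1 + 2 * lam * d) ≤ m) (hn : 2 * m ≤ n) :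
    cavityError d lam n ≤ 16 * Real.exp (-((n + 1) / Real.sqrt (1 + 2 * lam * d))) := by
  have hs := one_lt_sqrt_scale hd hlam
  have hn' : (2 : ℝ) * m ≤ n := by exact_mod_cast hn
  exact cavityError_le_exp n (by linarith) (by linarith)

theorem abs_scaFreeEnergy_sub_le {lam ε : ℝ} (hd : 0 < d) (hlam : 0 < lam) (hε : 0 < ε) :
    |(scaFreeEnergy d lam ε).val - -logCavityLimit lam (cavityHalf d)| ≤ ε := by
  obtain ⟨m, hm, hsm, hexp⟩ := exists_scaDepth_eq hd hlam hε
  have hs := one_lt_sqrt_scale hd hlam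
  rw [val_scaFreeEnergy, hm, ← neg_sub', abs_neg]
  refine (abs_log_cavityValue_sub_limit_le hd hlam _ _).trans
    ((cavityError_le_of_two_mul_le hd hlam hsm le_rfl).trans ?_)
  have : Real.exp (-((((2 * m : ℕ) : ℝ) + 1) / Real.sqrt (1 + 2 * lam * d))) ≤
      Real.exp (-(m / Real.sqrt (1 + 2 * lam * d))) := by
    rw [Real.exp_le_exp, neg_le_neg_iff]
    gcongr
    push_cast
    have : (0 : ℝ) ≤ m := Nat.cast_nonneg _
    linarith
  linarith

/-- Put `e = exp(-m/s)`. Depth `2m` gives errors of order `E = e²`: in the `2m` retained terms one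
factor `e` absorbs `m` through `m e ≤ s`, leaving `64 s e`. The tail is geometric with ratio `r =
exp(-1/s)`, and `r/(1-r) ≤ s` gives `32 s e`. -/
theorem abs_sum_sub_tsum_faceExcess_le {lam : ℝ} (hd : 0 < d) (hlam : 0 < lam) {m : ℕ}
    (hm : Real.sqrt (1 + 2 * lam * d) ≤ m) (f : Fin d × Bool) :
    |∑ k ∈ Finset.range (2 * m), (Real.log (cavityValue lam (cavityHalf d) (fun _ _ => 1) (2 * m) [] 0) -
        Real.log (cavityValue lam (faceRegion f k) (fun _ _ => 1) (2 * m) [] 0)) -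
      ∑' k, faceExcess lam f k| ≤
      96 * Real.sqrt (1 + 2 * lam * d) * Real.exp (-(m / Real.sqrt (1 + 2 * lam * d))) := by
  have hs := one_lt_sqrt_scale hd hlam
  have herr : ∀ n, 2 * m ≤ n → cavityError d lam n ≤ _ := fun n hn =>
    cavityError_le_of_two_mul_le hd hlam hm hn
  have hlim := fun R => abs_log_cavityValue_sub_limit_le (d := d) hd hlam R (2 * m)
  have hface := abs_faceExcess_le hd hlam f
  have hsum := summable_faceExcess hd hlam f
  set s := Real.sqrt (1 + 2 * lam * d)
  have hspos : 0 < s := by linarith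
  set E := Real.exp (-(((2 * m : ℕ) : ℝ) / s)) with hE
  set r := Real.exp (-(1 / s)) with hr
  have hr1 : r < 1 := Real.exp_lt_one_iff.2 (by rw [neg_lt_zero]; positivity)
  have hexp : ∀ k : ℕ, Real.exp (-((((k + 2 * m : ℕ) : ℝ) + 1) / s)) = E * r * r ^ k := fun k => by
    rw [hE, hr, ← Real.exp_nat_mul, ← Real.exp_add, ← Real.exp_add]
    congr 1
    push_cast
    ring
  have htail : ‖∑' k, faceExcess lam f (k + 2 * m)‖ ≤ 32 * (E * r) * (1 - r)⁻¹ := by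
    refine tsum_of_norm_bounded
      ((hasSum_geometric_of_lt_one (Real.exp_pos _).le hr1).mul_left (32 * (E * r))) fun k => ?_
    rw [Real.norm_eq_abs]
    have h1 := (hface (k + 2 * m)).trans
      (mul_le_mul_of_nonneg_left (herr (k + 2 * m) (by omega)) zero_le_two)
    rw [hexp k] at h1
    linarith
  have hrs : r * (1 - r)⁻¹ ≤ s := by
    rw [← div_eq_mul_inv, div_le_iff₀ (by linarith)]
    have h1 : 1 / s + 1 ≤ Real.exp (1 / s) := Real.add_one_le_exp _
    have h2 : r * Real.exp (1 / s) = 1 := by rw [hr, ← Real.exp_add]; simp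
    have h3 : 0 < r := Real.exp_pos _
    have h4 : r * (1 / s + 1) ≤ 1 := (mul_le_mul_of_nonneg_left h1 h3.le).trans_eq h2
    have h5 : r * (1 / s + 1) * s = r * (1 + s) := by field_simp
    nlinarith
  have hhead : |∑ k ∈ Finset.range (2 * m),
      (Real.log (cavityValue lam (cavityHalf d) (fun _ _ => 1) (2 * m) [] 0) -
        Real.log (cavityValue lam (faceRegion f k) (fun _ _ => 1) (2 * m) [] 0)) -
      ∑ k ∈ Finset.range (2 * m), faceExcess lam f k| ≤ 2 * m * (2 * (16 * E)) := by
    have herr0 : cavityError d lam (2 * m) ≤ 16 * E := by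
      refine (herr _ le_rfl).trans ?_
      have := hexp 0
      rw [zero_add, pow_zero, mul_one] at this
      rw [this]
      have hEpos : 0 < E := Real.exp_pos _
      nlinarith
    rw [← Finset.sum_sub_distrib]
    refine (Finset.abs_sum_le_sum_abs _ _).trans ((Finset.sum_le_card_nsmul _ _ (2 * (16 * E))
      fun k _ => ?_).trans (by rw [Finset.card_range, nsmul_eq_mul]; push_cast; exact le_rfl))
    have h1 := hlim (cavityHalf d)
    have h2 := hlim (faceRegion f k)
    rw [faceExcess]
    rw [abs_le] at *
    constructor <;> linarith [h1.1, h1.2, h2.1, h2.2]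
  rw [← hsum.sum_add_tsum_nat_add (2 * m), ← sub_sub]
  have hEm : E = Real.exp (-(m / s)) * Real.exp (-(m / s)) := by
    rw [hE, ← Real.exp_add]; congr 1; push_cast; ring
  have hm_le : m * Real.exp (-(m / s)) ≤ s := by
    have h1 : (m : ℝ) / s + 1 ≤ Real.exp (m / s) := Real.add_one_le_exp _
    have h2 : Real.exp (-(m / s)) * Real.exp (m / s) = 1 := by rw [← Real.exp_add]; simp
    have h3 : (m : ℝ) ≤ s * Real.exp (m / s) := by
      rw [mul_comm, ← div_le_iff₀ hspos]; linarith
    calc m * Real.exp (-(m / s)) ≤ s * Real.exp (m / s) * Real.exp (-(m / s)) := by gcongr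
      _ = s := by rw [mul_assoc, mul_comm (Real.exp (m / s)), h2, mul_one]
  set e := Real.exp (-(m / s))
  have he0 : 0 < e := Real.exp_pos _
  have he1 : e ≤ 1 := Real.exp_le_one_iff.2 (by rw [neg_nonpos]; positivity)
  rw [Real.norm_eq_abs] at htail
  refine (abs_sub _ _).trans ((add_le_add hhead htail).trans ?_)
  have h1 : 2 * m * (2 * (16 * E)) ≤ 64 * s * e := by
    rw [hEm]
    nlinarith [mul_le_mul_of_nonneg_right hm_le he0.le]
  have h2 : 32 * (E * r) * (1 - r)⁻¹ ≤ 32 * s * e := by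
    have h3 : E ≤ e := by rw [hEm]; nlinarith
    calc 32 * (E * r) * (1 - r)⁻¹ = 32 * E * (r * (1 - r)⁻¹) := by ring
      _ ≤ 32 * e * s := by
          have hEpos : 0 < E := Real.exp_pos _
          gcongr
      _ = _ := by ring
  linarith

/-- The weights sum to `1`, so an error `ε/2` for each of the two faces of a direction suffices. The
target `δ = ε/s` cancels the factor `s` in the truncation error. -/
theorem abs_scaSurfacePressure_sub_le {lam ε : ℝ} (hd : 0 < d) (hlam : 0 < lam) (hε : 0 < ε)
    {a : Fin d → ℝ} (ha : ∀ i, 0 < a i) :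
    |(scaSurfacePressure d lam a ε).val - surfacePressureValue lam a| ≤ ε := by
  have hs := one_lt_sqrt_scale hd hlam
  have hspos : 0 < Real.sqrt (1 + 2 * lam * d) := by linarith
  obtain ⟨m, hm, hsm, hexp⟩ := exists_scaDepth_eq hd hlam (div_pos hε hspos)
  rw [val_scaSurfacePressure, hm]
  set s := Real.sqrt (1 + 2 * lam * d)
  have hw : ∀ j, 0 < 1 / a j / ∑ i, 1 / a i := fun j =>
    div_pos (one_div_pos.2 (ha j)) (Finset.sum_pos (fun i _ => one_div_pos.2 (ha i)) ⟨j, by simp⟩)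
  have hw1 : ∑ j, 1 / a j / ∑ i, 1 / a i = 1 := by
    have : Nonempty (Fin d) := ⟨⟨0, hd⟩⟩
    rw [← Finset.sum_div]
    exact div_self (Finset.sum_pos (fun i _ => one_div_pos.2 (ha i)) Finset.univ_nonempty).ne'
  have hval : surfacePressureValue lam a = ∑ j, 1 / a j / (∑ i, 1 / a i) *
      (∑' k, faceExcess lam (j, true) k + ∑' k, faceExcess lam (j, false) k) := by
    rw [surfacePressureValue, Finset.sum_div, Fintype.sum_prod_type]
    refine Finset.sum_congr rfl fun j _ => ?_
    rw [Fintype.sum_bool, ← area_div_surfaceArea ha j]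
    ring
  rw [hval, ← Finset.sum_sub_distrib]
  refine (Finset.abs_sum_le_sum_abs _ _).trans ((Finset.sum_le_sum (g := fun j =>
    1 / a j / (∑ i, 1 / a i) * ε) fun j _ => ?_).trans (by rw [← Finset.sum_mul, hw1, one_mul]))
  rw [← mul_sub, abs_mul, abs_of_pos (hw j)]
  refine mul_le_mul_of_nonneg_left ?_ (hw j).le
  have h1 := abs_sum_sub_tsum_faceExcess_le hd hlam hsm (j, true)
  have h2 := abs_sum_sub_tsum_faceExcess_le hd hlam hsm (j, false)
  simp only [faceRegion, if_true, Bool.false_eq_true, if_false] at h1 h2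
  have hbound : 96 * s * Real.exp (-(m / s)) ≤ ε / 2 := by
    have h3 : s * Real.exp (-(m / s)) ≤ s * (ε / s / 1024) :=
      mul_le_mul_of_nonneg_left hexp hspos.le
    have h4 : s * (ε / s / 1024) = ε / 1024 := by field_simp
    linarith
  have hsplit : ∀ (l : ℝ) (u w : ℕ → ℝ), ∑ k ∈ Finset.range (2 * m), (2 * l - u k - w k) =
      ∑ k ∈ Finset.range (2 * m), (l - u k) + ∑ k ∈ Finset.range (2 * m), (l - w k) := by
    intro l u w
    rw [← Finset.sum_add_distrib]
    exact Finset.sum_congr rfl fun k _ => by ring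
  rw [hsplit, add_sub_add_comm]
  refine (abs_add_le _ _).trans ?_
  linarith

/-! ### Running time of the algorithm -/

theorem scaDepth_le {lam δ : ℝ} (hd : 0 < d) (hlam : 0 < lam) (hδ : 0 < δ) :
    20 ≤ (scaDepth d lam δ).val ∧ ((scaDepth d lam δ).val : ℝ) ≤
      22 * (Real.sqrt (1 + 2 * lam * d) * (1 + Real.log (1 + 1 / δ))) := by
  have hs := one_lt_sqrt_scale hd hlam
  rw [val_scaDepth]
  set s := Real.sqrt (1 + 2 * lam * d)
  have hL : 0 ≤ Real.log (1 + 1 / δ) := Real.log_nonneg (by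
    have : 0 < 1 / δ := by positivity
    linarith)
  set x := s * (1 + Real.log (1 + 1 / δ))
  have hx : 1 ≤ x := by
    nlinarith [mul_nonneg (by linarith : (0 : ℝ) ≤ s) hL]
  constructor
  · have : (10 : ℝ) ≤ ⌈10 * x⌉₊ := le_trans (by linarith) (Nat.le_ceil _)
    have : 10 ≤ ⌈10 * x⌉₊ := by exact_mod_cast this
    omega
  · have := (Nat.ceil_lt_add_one (by linarith : 0 ≤ 10 * x)).le
    push_cast
    linarith

/-- From `t ≥ 20`, `13 + 5t ≤ 6t`. The prefactor `log (2 + 2λd)` may be below `1` but is at least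
`1/d`, so one more factor `d` compensates. The exponent constant is then `7 · 22 · 2 · 4 = 1232 ≤
2000`. -/
theorem pow_depth_le {lam B L : ℝ} (hd : 2 ≤ d) (hlam : 0 < lam) (hB : 2 ≤ B) {t n : ℕ}
    (ht : 20 ≤ t) (htL : (t : ℝ) ≤ 22 * (Real.sqrt (1 + 2 * lam * d) * (1 + L)))
    (hL : 1 + L ≤ 4 * Real.log B) (hn : n ≤ d ^ (13 + 5 * t)) :
    (n : ℝ) ≤ Real.log (2 + 2 * lam * d) *
      B ^ (2000 * Real.sqrt (1 + lam * d) * Real.log d) := by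
  have hd' : (2 : ℝ) ≤ d := by exact_mod_cast hd
  have hlogd : 0 < Real.log d := Real.log_pos (by linarith)
  have hlam' : 0 < lam * d := by positivity
  have hhalf : 1 / (d : ℝ) ≤ Real.log (2 + 2 * lam * d) := by
    calc 1 / (d : ℝ) ≤ 1 / 2 := one_div_le_one_div_of_le two_pos hd'
      _ ≤ Real.log 2 := by linarith [Real.log_two_gt_d9]
      _ ≤ _ := Real.log_le_log two_pos (by linarith)
  have hs : Real.sqrt (1 + 2 * lam * d) ≤ 2 * Real.sqrt (1 + lam * d) := by
    rw [Real.sqrt_le_left (by positivity), mul_pow, Real.sq_sqrt (by linarith)]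
    linarith
  have hlogB : 0 < Real.log B := Real.log_pos (by linarith)
  have hpow : (d : ℝ) ^ (6 * t + 1) ≤ B ^ (2000 * Real.sqrt (1 + lam * d) * Real.log d) := by
    rw [Real.rpow_def_of_pos (by linarith), ← Real.log_le_iff_le_exp (by positivity), Real.log_pow]
    have h1 : (((6 * t + 1 : ℕ) : ℝ)) ≤ 7 * t := by
      have : (20 : ℝ) ≤ t := by exact_mod_cast ht
      push_cast
      linarith
    have h2 : Real.sqrt (1 + 2 * lam * d) * (1 + L) ≤
        2 * Real.sqrt (1 + lam * d) * (4 * Real.log B) := by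
      calc _ ≤ Real.sqrt (1 + 2 * lam * d) * (4 * Real.log B) := by gcongr
        _ ≤ _ := by gcongr
    have h3 : 0 ≤ Real.sqrt (1 + lam * d) * Real.log B := by positivity
    have h4 : (((6 * t + 1 : ℕ) : ℝ)) ≤ 2000 * (Real.sqrt (1 + lam * d) * Real.log B) := by
      linarith
    calc _ ≤ 2000 * (Real.sqrt (1 + lam * d) * Real.log B) * Real.log d := by gcongr
      _ = _ := by ring
  have hn' : (n : ℝ) ≤ (d : ℝ) ^ (6 * t) := by
    calc (n : ℝ) ≤ (d : ℝ) ^ (13 + 5 * t) := by exact_mod_cast hn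
      _ ≤ _ := pow_le_pow_right₀ (by linarith) (by omega)
  calc (n : ℝ) ≤ (d : ℝ) ^ (6 * t) := hn'
    _ = 1 / d * (d : ℝ) ^ (6 * t + 1) := by rw [pow_succ]; field_simp
    _ ≤ _ := mul_le_mul hhalf hpow (by positivity) (le_trans (by positivity) hhalf)

theorem steps_scaFreeEnergy_le_rpow {lam ε : ℝ} (hd : 2 ≤ d) (hlam : 0 < lam) (hε : 0 < ε) :
    ((scaFreeEnergy d lam ε).steps : ℝ) ≤ Real.log (2 + 2 * lam * d) *
      (2 + 1 / ε) ^ (2000 * Real.sqrt (1 + lam * d) * Real.log d) := by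
  obtain ⟨h1, h2⟩ := scaDepth_le (δ := ε) (by omega : 0 < d) hlam hε
  have hε' : 0 < 1 / ε := by positivity
  refine pow_depth_le hd hlam (by linarith) h1 h2 ?_ (steps_scaFreeEnergy_le hd lam ε)
  have h3 : Real.log 2 ≤ Real.log (2 + 1 / ε) := Real.log_le_log two_pos (by linarith)
  have h4 : Real.log (1 + 1 / ε) ≤ Real.log (2 + 1 / ε) :=
    Real.log_le_log (by linarith) (by linarith)
  linarith [Real.log_two_gt_d9]

theorem steps_scaSurfacePressure_le_rpow {lam ε : ℝ} (hd : 2 ≤ d) (hlam : 0 < lam) (hε : 0 < ε)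
    (a : Fin d → ℝ) :
    ((scaSurfacePressure d lam a ε).steps : ℝ) ≤ Real.log (2 + 2 * lam * d) *
      (2 + lam * d + 1 / ε) ^ (2000 * Real.sqrt (1 + lam * d) * Real.log d) := by
  have hs := one_lt_sqrt_scale (by omega : 0 < d) hlam
  obtain ⟨h1, h2⟩ := scaDepth_le (δ := ε / Real.sqrt (1 + 2 * lam * d)) (by omega : 0 < d) hlam
    (div_pos hε (by linarith))
  have hε' : 0 < 1 / ε := by positivity
  have hlam' : 0 < lam * d := by
    have : (0 : ℝ) < d := by exact_mod_cast (by omega : 0 < d)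
    positivity
  refine pow_depth_le hd hlam (by linarith) h1 h2 ?_ (steps_scaSurfacePressure_le hd lam a ε)
  have h3 : Real.log 2 ≤ Real.log (2 + lam * d + 1 / ε) := Real.log_le_log two_pos (by linarith)
  have hsq : Real.sqrt (1 + 2 * lam * d) ≤ 1 + lam * d := by
    rw [Real.sqrt_le_left (by linarith)]
    nlinarith [sq_nonneg (lam * d)]
  -- With `s ≤ 1 + λd`, `1 + s/ε ≤ (2 + λd + 1/ε)²`: the sharper target `ε/s` is paid for by the
  -- term `λd` in the base.
  have h4 : Real.log (1 + 1 / (ε / Real.sqrt (1 + 2 * lam * d))) ≤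
      2 * Real.log (2 + lam * d + 1 / ε) := by
    have e : 2 * Real.log (2 + lam * d + 1 / ε) = Real.log ((2 + lam * d + 1 / ε) ^ 2) := by
      rw [Real.log_pow]; norm_num
    rw [e, one_div_div, div_eq_mul_one_div]
    refine Real.log_le_log (by positivity) ?_
    have h5 : Real.sqrt (1 + 2 * lam * d) * (1 / ε) ≤ (1 + lam * d) * (1 / ε) := by gcongr
    nlinarith [mul_pos hlam' hε', sq_nonneg (1 / ε), sq_nonneg (lam * d)]
  linarith [Real.log_two_gt_d9]

end

theorem proposition4 :
    ∃ C : ℝ, 0 < C ∧ ∀ d : ℕ, 2 ≤ d → ∀ lam : ℝ, 0 < lam →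
      ∃ P : ℝ, IsFreeEnergy d lam P ∧
        (∀ ε : ℝ, 0 < ε →
          |(scaFreeEnergy d lam ε).val - P| ≤ ε ∧
          ((scaFreeEnergy d lam ε).steps : ℝ) ≤
            Real.log (2 + 2 * lam * d) *
              (2 + 1 / ε) ^ (C * Real.sqrt (1 + lam * d) * Real.log d)) ∧
        ∀ a : Fin d → ℝ, (∀ i, 0 < a i) →
          ∃ s : ℝ, IsSurfacePressure d lam P a s ∧
            ∀ ε : ℝ, 0 < ε →
              |(scaSurfacePressure d lam a ε).val - s| ≤ ε ∧
              ((scaSurfacePressure d lam a ε).steps : ℝ) ≤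
                Real.log (2 + 2 * lam * d) *
                  (2 + lam * d + 1 / ε) ^ (C * Real.sqrt (1 + lam * d) * Real.log d) := by

  refine ⟨2000, by norm_num, fun d hd lam hlam => ?_⟩
  have hd0 : 0 < d := by omega
  refine ⟨-logCavityLimit lam (cavityHalf d), isFreeEnergy_neg_logCavityLimit hd0 hlam,
    fun ε hε => ⟨abs_scaFreeEnergy_sub_le hd0 hlam hε, steps_scaFreeEnergy_le_rpow hd hlam hε⟩,
    fun a ha => ⟨surfacePressureValue lam a, isSurfacePressure_surfacePressureValue hd0 hlam ha,
      fun ε hε => ⟨abs_scaSurfacePressure_sub_le hd0 hlam hε ha,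
        steps_scaSurfacePressure_le_rpow hd hlam hε a⟩⟩⟩
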